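/- A (finite) planar space $f=(\mathcal P,\mathcal L,\mathcal H)$ consists of a finite set $\mathcal P$ of points and sets $\mathcal L,\mathcal H\subseteq 2^{\mathcal P}$ of lines and planes such that every line has at least two points, any two distinct points lie on exactly one line, and any three distinct non-collinear points lie on exactly one plane. A set $S\subseteq\mathcal P$ is called collinear if it has at most one point or is contained in a line $L\in\mathcal L$; it is called coplanar if it is collinear or contained in a plane $H\in\mathcal H$. A strong realization of $f$ in $\mathbb P^3(\mathbb F_q)$ is an injective map $\sigma:\mathcal P\to\mathbb P^3(\mathbb F_q)$ such that for every $S\subseteq\mathcal P$, $\sigma(S)$ is contained in a line of $\mathbb P^3(\mathbb F_q)$ if and only if $S$ is collinear, and $\sigma(S)$ is contained in a plane of $\mathbb P^3(\mathbb F_q)$ if and only if $S$ is coplanar. Let $A_f(4,q)$ be the number of strong realizations of $f$ in $\mathbb P^3(\mathbb F_q)$. Two planar spaces are isomorphic if there is a bijection between their point sets that preserves collinearity and coplanarity of sets in both directions. A full line is a line with at least three points; a full plane is a plane with at least four points, not all collinear. A point has index $(i,j)$ if it lies on exactly $i$ full planes and exactly $j$ full lines. A hyperfiguration is a planar space with at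 least one point in which the index $(i,j)$ of every point satisfies $i\ge 4$, or $j\ge 3$, or $(i,j)=(3,0)$. Statement. For every planar space $f$ on $n$ points there exist polynomials $r(q)$ and $r_h(q)$ in $\mathbb Z[q]$, one $r_h$ for each isomorphism class $h$ of hyperfigurations on at most $n$ points, such that for every prime power $q$ $$A_f(4,q)=r(q)+\sum_h r_h(q)\,A_h(4,q),$$ where the sum runs over all isomorphism classes $h$ of hyperfigurations on at most $n$ points. Moreover, there is an algorithm, the same for all $n$, $f$ and $h$, that produces these polynomials: there are computable functions, one of which takes a description of $f$ (the number of points and the lists of lines and planes) to the list of coefficients of $r$, and the other of which takes a description of $f$ and a description of any hyperfiguration in a class $h$ to the list of coefficients of $r_h$. -/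

import Mathlib

open Polynomial LinearAlgebra.Projectivization

universe u v w

/-- A planar space on the set of points `P`: a linear space `(P, lines)` together with a set of
planes such that any three distinct non-collinear points lie on a unique plane. -/
@[ext]
structure PlanarSpace (P : Type u) where
  lines : Set (Set P)
  planes : Set (Set P)
  existsUnique_line : ∀ a b : P, a ≠ b → ∃! L : Set P, L ∈ lines ∧ a ∈ L ∧ b ∈ L
  nontrivial_of_line : ∀ L ∈ lines, ∃ a ∈ L, ∃ b ∈ L, a ≠ b
  existsUnique_plane : ∀ a b c : P, a ≠ b → a ≠ c → b ≠ c →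
    (¬ ∃ L ∈ lines, a ∈ L ∧ b ∈ L ∧ c ∈ L) →
    ∃! H : Set P, H ∈ planes ∧ a ∈ H ∧ b ∈ H ∧ c ∈ H

namespace PlanarSpace

variable {P : Type u} {Q : Type v}

/-- A set of points is collinear if it lies on a line of the space (a set with at most one point
is always collinear, even if the space has no lines). -/
def Collinear (f : PlanarSpace P) (S : Set P) : Prop :=
  S.Subsingleton ∨ ∃ L ∈ f.lines, S ⊆ L

/-- A set of points is coplanar if it lies on a plane of the space; collinear sets are always
coplanar. -/
def Coplanar (f : PlanarSpace P) (S : Set P) : Prop :=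
  f.Collinear S ∨ ∃ H ∈ f.planes, S ⊆ H

/-- Full lines: lines with at least three points. -/
def IsFullLine (f : PlanarSpace P) (L : Set P) : Prop :=
  L ∈ f.lines ∧ 3 ≤ L.encard

/-- Full planes: planes with at least four points. A member of `planes` all of whose points are on
one line is not determined by a non-collinear triple, carries no information, and is not counted. -/
def IsFullPlane (f : PlanarSpace P) (H : Set P) : Prop :=
  H ∈ f.planes ∧ 4 ≤ H.encard ∧ ¬ f.Collinear H

/-- The number of full planes through `p`: the first entry of the index of `p`. -/
noncomputable def planeIndex (f : PlanarSpace P) (p : P) : ℕ :=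
  {H : Set P | f.IsFullPlane H ∧ p ∈ H}.ncard

/-- The number of full lines through `p`: the second entry of the index of `p`. -/
noncomputable def lineIndex (f : PlanarSpace P) (p : P) : ℕ :=
  {L : Set P | f.IsFullLine L ∧ p ∈ L}.ncard

/-- Hyperfigurations: nonempty planar spaces in which the index `(i, j)` of every point satisfies
`i ≥ 4`, or `j ≥ 3`, or `(i, j) = (3, 0)`. -/
def IsHyperfiguration (f : PlanarSpace P) : Prop :=
  Nonempty P ∧ ∀ p : P, 4 ≤ f.planeIndex p ∨ 3 ≤ f.lineIndex p ∨
    (f.planeIndex p = 3 ∧ f.lineIndex p = 0)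

/-- Isomorphism of planar spaces: a bijection of the points that preserves lines and planes. -/
def Iso (f : PlanarSpace P) (g : PlanarSpace Q) : Prop :=
  ∃ e : P ≃ Q, (∀ S : Set P, g.Collinear (e '' S) ↔ f.Collinear S) ∧
    ∀ S : Set P, g.Coplanar (e '' S) ↔ f.Coplanar S

theorem Iso.refl (f : PlanarSpace P) : f.Iso f :=
  ⟨Equiv.refl P, by simp, by simp⟩

theorem Iso.symm {f : PlanarSpace P} {g : PlanarSpace Q} (h : f.Iso g) : g.Iso f := by
  obtain ⟨e, h1, h2⟩ := h
  refine ⟨e.symm, fun S => ?_, fun S => ?_⟩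
  · rw [← h1, Equiv.image_symm_image]
  · rw [← h2, Equiv.image_symm_image]

theorem Iso.trans {R : Type w} {f : PlanarSpace P} {g : PlanarSpace Q} {k : PlanarSpace R}
    (h : f.Iso g) (h' : g.Iso k) : f.Iso k := by
  obtain ⟨e, h1, h2⟩ := h
  obtain ⟨e', h1', h2'⟩ := h'
  refine ⟨e.trans e', fun S => ?_, fun S => ?_⟩
  · rw [← h1, ← h1', Equiv.coe_trans, Set.image_comp]
  · rw [← h2, ← h2', Equiv.coe_trans, Set.image_comp]

end PlanarSpace

/-- Three-dimensional projective space over `K`. -/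
abbrev ProjSpace3 (K : Type v) [Field K] : Type v := ℙ K (Fin 4 → K)

/-- A set of points of projective 3-space is contained in a line, that is, in the projectivization
of a 2-dimensional subspace of `K ^ 4`. -/
def InProjLine {K : Type v} [Field K] (T : Set (ProjSpace3 K)) : Prop :=
  ∃ W : Submodule K (Fin 4 → K), Module.finrank K W = 2 ∧ ∀ x ∈ T, x.submodule ≤ W

/-- A set of points of projective 3-space is contained in a plane, that is, in the projectivization
of a 3-dimensional subspace of `K ^ 4`. -/
def InProjPlane {K : Type v} [Field K] (T : Set (ProjSpace3 K)) : Prop :=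
  ∃ W : Submodule K (Fin 4 → K), Module.finrank K W = 3 ∧ ∀ x ∈ T, x.submodule ≤ W

namespace PlanarSpace

variable {P : Type u} {Q : Type w}

/-- Strong realizations of `f` in projective 3-space over `K`: injective maps which preserve lines
and planes in both directions. -/
structure StrongRealization (f : PlanarSpace P) (K : Type v) [Field K] where
  toFun : P → ProjSpace3 K
  injective : Function.Injective toFun
  line_iff : ∀ S : Set P, InProjLine (toFun '' S) ↔ f.Collinear S
  plane_iff : ∀ S : Set P, InProjPlane (toFun '' S) ↔ f.Coplanar S

/-- `A_f(4, q)`, where `q` is the order of `K`: the number of strong realizations of `f`. -/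
noncomputable def numRealizations (f : PlanarSpace P) (K : Type v) [Field K] : ℕ :=
  Nat.card (f.StrongRealization K)

theorem StrongRealization.ext_toFun {f : PlanarSpace P} {K : Type v} [Field K]
    {s t : f.StrongRealization K} (h : s.toFun = t.toFun) : s = t := by
  cases s; cases t; cases h; rfl

/-- Isomorphic planar spaces have the same number of strong realizations. -/
theorem Iso.numRealizations_eq {f : PlanarSpace P} {g : PlanarSpace Q} (h : f.Iso g)
    (K : Type v) [Field K] : f.numRealizations K = g.numRealizations K := by
  obtain ⟨e, h1, h2⟩ := h
  refine Nat.card_congr ⟨fun s => ⟨s.toFun ∘ e.symm, s.injective.comp e.symm.injective, ?_, ?_⟩,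
    fun s => ⟨s.toFun ∘ e, s.injective.comp e.injective, ?_, ?_⟩, ?_, ?_⟩
  · intro S
    rw [Set.image_comp, s.line_iff, ← h1, Equiv.image_symm_image]
  · intro S
    rw [Set.image_comp, s.plane_iff, ← h2, Equiv.image_symm_image]
  · intro S
    rw [Set.image_comp, s.line_iff, h1]
  · intro S
    rw [Set.image_comp, s.plane_iff, h2]
  · intro s
    apply StrongRealization.ext_toFun
    funext p
    simp
  · intro s
    apply StrongRealization.ext_toFun
    funext p
    simp

instance instFinite [Finite P] : Finite (PlanarSpace P) :=
  Finite.of_injective (fun f : PlanarSpace P => (f.lines, f.planes)) (by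
    intro f g h
    have h' := Prod.mk.inj h
    exact PlanarSpace.ext h'.1 h'.2)

end PlanarSpace

/-- The hyperfigurations on at most `n` points, on the point sets `{0, …, m - 1}` with `m ≤ n`. -/
structure Hyperfiguration (n : ℕ) where
  size : Fin (n + 1)
  space : PlanarSpace (Fin size)
  isHyperfiguration : space.IsHyperfiguration

namespace Hyperfiguration

instance instFinite (n : ℕ) : Finite (Hyperfiguration n) :=
  Finite.of_injective
    (fun h : Hyperfiguration n => (⟨h.size, h.space⟩ : Σ m : Fin (n + 1), PlanarSpace (Fin m))) (by
    intro h k hk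
    cases h; cases k
    simp only [Sigma.mk.injEq] at hk
    obtain ⟨h1, h2⟩ := hk
    subst h1
    cases h2
    rfl)

/-- Isomorphism as an equivalence relation on the hyperfigurations on at most `n` points. -/
instance isoSetoid (n : ℕ) : Setoid (Hyperfiguration n) where
  r h k := h.space.Iso k.space
  iseqv := ⟨fun h => .refl h.space, fun h => h.symm, fun h k => h.trans k⟩

end Hyperfiguration

/-- The isomorphism classes of hyperfigurations on at most `n` points. -/
abbrev HyperfigurationClass (n : ℕ) : Type := Quotient (Hyperfiguration.isoSetoid n)

namespace HyperfigurationClass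

noncomputable instance instFintype (n : ℕ) : Fintype (HyperfigurationClass n) :=
  Fintype.ofFinite _

/-- `A_h(4, q)` for an isomorphism class `h`. -/
noncomputable def numRealizations {n : ℕ} (h : HyperfigurationClass n) (K : Type v) [Field K] : ℕ :=
  Quotient.lift (fun k : Hyperfiguration n => k.space.numRealizations K)
    (fun _ _ hk => PlanarSpace.Iso.numRealizations_eq hk K) h

end HyperfigurationClass

/-- Finite descriptions of planar spaces, as inputs of algorithms: the number `n` of points, the
list of the lines and the list of the planes, each given as a list of labels of points; the points
are labelled by `0, …, n - 1`. -/
abbrev PlanarCode : Type := ℕ × List (List ℕ) × List (List ℕ)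

/-- `c` describes `f`, for some labelling `e` of the points. -/
def PlanarCode.Describes {P : Type u} (c : PlanarCode) (f : PlanarSpace P) : Prop :=
  ∃ e : P ≃ Fin c.1,
    f.lines = {L | ∃ l ∈ c.2.1, L = {p | (e p : ℕ) ∈ l}} ∧
    f.planes = {H | ∃ l ∈ c.2.2, H = {p | (e p : ℕ) ∈ l}}

theorem PlanarCode.exists_list_of_sets {P : Type u} {n : ℕ} (e : P ≃ Fin n) (T : Set (Set P)) :
    ∃ ls : List (List ℕ), T = {L | ∃ l ∈ ls, L = {p | (e p : ℕ) ∈ l}} := by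
  classical
  have : Finite P := Finite.of_equiv _ e.symm
  let toList : Set P → List ℕ := fun S => ((Set.toFinite S).toFinset.image fun p => (e p : ℕ)).toList
  have key : ∀ S : Set P, S = {p | (e p : ℕ) ∈ toList S} := by
    intro S
    ext p
    simp only [toList, Set.mem_ofPred_eq, Finset.mem_toList, Finset.mem_image,
      Set.Finite.mem_toFinset]
    constructor
    · intro h
      exact ⟨p, h, rfl⟩
    · rintro ⟨p', h, h'⟩
      rwa [← e.injective (Fin.ext h')]
  refine ⟨(Set.toFinite T).toFinset.toList.map toList, ?_⟩
  ext L
  simp only [List.mem_map, Finset.mem_toList, Set.Finite.mem_toFinset, Set.mem_ofPred_eq,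
    exists_exists_and_eq_and]
  constructor
  · intro h
    exact ⟨L, h, key L⟩
  · rintro ⟨L', h, h'⟩
    rwa [h', ← key L']

/-- Every finite planar space has a description. -/
theorem PlanarCode.exists_describes {P : Type u} [Finite P] (f : PlanarSpace P) :
    ∃ c : PlanarCode, c.Describes f := by
  obtain ⟨ls, h1⟩ := PlanarCode.exists_list_of_sets (Finite.equivFin P) f.lines
  obtain ⟨hs, h2⟩ := PlanarCode.exists_list_of_sets (Finite.equivFin P) f.planes
  exact ⟨(Nat.card P, ls, hs), Finite.equivFin P, h1, h2⟩

/-- The polynomial with the given list of coefficients, constant coefficient first. -/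
noncomputable def polyOfCoeffs (l : List ℤ) : ℤ[X] :=
  l.foldr (fun a p => C a + X * p) 0

/-! The idea is to work with a class of configurations larger than that of planar spaces. A type
lists the labels of the points together with all sets of labels that are to be independent in `K ^
4`. Its count is the number of placements of the labels with exactly these independent sets.
Coincident points are allowed, and so are types that no configuration realizes. For the type of a
planar space this count is the number of strong realizations (`Matches.count_eq`), because
collinearity and coplanarity are decided on triples and quadruples.

Fix a label `p` and a placement of the other points. The placements of `p` with at least the
prescribed dependencies are those on every span of an independent set whose closure contains `p`. If
at most two of these spans are minimal, the positions of `p` form a subspace. Its dimension `d` can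
be read off from the type by Grassmann's formula, or is 4 if there are no constraints. So there are
`1 + q + ... + q ^ (d - 1)` positions for each configuration of the remaining points. Sorting the
same placements by the sets through `p` that stay independent gives the count of the type itself
plus the counts of its degenerations. Equating the two (`ncard_extensions_eq_mul`,
`ncard_extensions_eq_sum`) expresses the count through types with fewer labels or fewer independent
sets, so the recursion ends (`run_spec`).

A terminal type without labels contributes a constant, which gives `r`. In a realizable terminal
type with labels all points are distinct, since two coincident points give a single minimal
constraint. The type is therefore that of a planar space. If the index of a point violated the
hyperfiguration condition, its constraints would have at most two minimal members
(`exists_minimal_constraints`) and the type would not be terminal. Hence the surviving types are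
hyperfigurations, or have count zero. All operations are on finite lists and are primitive
recursive, which gives the algorithm. -/

/-- Finite combinatorial types of point configurations: a list of labels of points, and the list of
the independent sets of labels. -/
abbrev ConfigType : Type := List ℕ × List (List ℕ)

/-- A signed monomial `± q ^ k` times the number of configurations of a type. -/
abbrev ConfigTerm : Type := Bool × ℕ × ConfigType

/-! ### The expansion algorithm on types. -/

namespace ConfigType

/-- Up to order and repetition, `A` is a member of `M`. -/
def Has (M : List (List ℕ)) (A : List ℕ) : Prop := ∃ T ∈ M, T ⊆ A ∧ A ⊆ T

/-- The label `y` is in the closure of the independent set `S`. -/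
def Cl (M : List (List ℕ)) (S : List ℕ) (y : ℕ) : Prop := y ∈ S ∨ ¬ Has M (y :: S)

instance (M A) : Decidable (Has M A) := by unfold Has; infer_instance

instance (M S y) : Decidable (Cl M S y) := by unfold Cl; infer_instance

/-- The independent sets which avoid `p`. -/
def del (M : List (List ℕ)) (p : ℕ) : List (List ℕ) := M.filter fun S => ¬ p ∈ S

/-- The independent sets which contain `p`. -/
def link (M : List (List ℕ)) (p : ℕ) : List (List ℕ) := M.filter fun S => p ∈ S

/-- No independent set of the other points spans `p`. -/
def IsFree (M : List (List ℕ)) (p : ℕ) : Prop := ∀ S ∈ del M p, ¬ Cl M S p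

/-- The constraints on the position of `p` say that it lies on the spans of two independent sets
`F.1`, `F.2.1`, and `F.2.2` is a basis of their union. -/
def IsMeet (M : List (List ℕ)) (p : ℕ) (F : List ℕ × List ℕ × List ℕ) : Prop :=
  (Cl M F.1 p ∧ Cl M F.2.1 p) ∧ (F.2.2 ⊆ F.1 ++ F.2.1 ∧ ∀ y ∈ F.1 ++ F.2.1, Cl M F.2.2 y) ∧
    -- Every closure that contains `p` contains one of the two given closures, so all other
    -- constraints follow from these. The two sets may coincide, which covers a single minimal
    -- constraint.
    ∀ S ∈ del M p, ¬ Cl M S p ∨ ((∀ y ∈ F.1, Cl M S y) ∨ ∀ y ∈ F.2.1, Cl M S y)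

instance (M p) : Decidable (IsFree M p) := by unfold IsFree; infer_instance

instance (M p F) : Decidable (IsMeet M p F) := by unfold IsMeet; infer_instance

/-- All triples of members of a list. -/
def triples (D : List (List ℕ)) : List (List ℕ × List ℕ × List ℕ) :=
  D.flatMap fun a => D.flatMap fun b => D.map fun c => (a, b, c)

/-- The points `p` whose positions relative to the other points form a subspace of known
dimension, with the vector space dimensions of these subspaces. -/
def choices (τ : ConfigType) : List (ℕ × ℕ) :=
  τ.1.flatMap fun p => (if IsFree τ.2 p then [(p, 4)] else []) ++
    ((triples (del τ.2 p)).filter fun F => IsMeet τ.2 p F).map fun F =>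
      (p, F.1.length + F.2.1.length - F.2.2.length)

/-- The types with the same points and at least the dependencies of `τ`, and with the same
dependencies among the points other than `p`, except `τ` itself. -/
def degenerations (τ : ConfigType) (p : ℕ) : List ConfigType :=
  ((link τ.2 p).sublists'.filter fun N => ¬ N = link τ.2 p).map fun N => (τ.1, del τ.2 p ++ N)

/-- Removal of a point. -/
def remove (τ : ConfigType) (p : ℕ) : ConfigType := (τ.1.filter fun x => ¬ x = p, del τ.2 p)

/-- One step of the expansion of the number of configurations of type `τ`. -/
def expandAt (τ : ConfigType) (c : ℕ × ℕ) : List ConfigTerm :=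
  ((List.range c.2).map fun i => (false, i, remove τ c.1)) ++
    (degenerations τ c.1).map fun g => (true, 0, g)

/-- One step of the expansion, at the first point at which it is possible. -/
def expand (τ : ConfigType) : List ConfigTerm :=
  -- With no choice left the type is returned with coefficient 1, so terminal types are fixed by
  -- further rounds.
  ((choices τ).head?.map fun c => expandAt τ c).getD [(false, 0, τ)]

/-- One step of the expansion of a linear combination. -/
def step (ts : List ConfigTerm) : List ConfigTerm :=
  ts.flatMap fun t => (expand t.2.2).map fun u => (xor t.1 u.1, t.2.1 + u.2.1, u.2.2)

/-- The complete expansion. -/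
def run (τ : ConfigType) : List ConfigTerm :=
  -- Each round lowers the number of labels plus the number of independent sets of every
  -- non-terminal type, so this many rounds suffice.
  step^[τ.1.length + τ.2.length] [(false, 0, τ)]

/-- All lists of length `n` of members of `V`. -/
def tuples (V : List ℕ) (n : ℕ) : List (List ℕ) :=
  Nat.rec [[]] (fun _ T => T.flatMap fun l => V.map fun x => x :: l) n

end ConfigType

/-- Independence of a set of labels in a description of a planar space. -/
def PlanarCode.Indep (c : PlanarCode) (S : List ℕ) : Prop :=
  S.length ≤ 2 ∨ (S.length = 3 ∧ ¬ ∃ l ∈ c.2.1, S ⊆ l) ∨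
    (S.length = 4 ∧ ¬ (∃ l ∈ c.2.1, S ⊆ l) ∧ ¬ ∃ l ∈ c.2.2, S ⊆ l)

instance (c : PlanarCode) (S : List ℕ) : Decidable (c.Indep S) := by
  unfold PlanarCode.Indep; infer_instance

/-- The type described by a code. -/
def PlanarCode.type (c : PlanarCode) : ConfigType :=
  (List.range c.1, (List.range c.1).sublists'.filter fun S => c.Indep S)

namespace ConfigType

/-- The type `τ` is isomorphic to the type of the planar space described by `d`. -/
def MatchesCode (τ : ConfigType) (d : PlanarCode) : Prop :=
  τ.1.length = d.1 ∧ ∃ l ∈ tuples τ.1 d.1, (∀ x ∈ τ.1, x ∈ l) ∧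
    ∀ S ∈ (List.range d.1).sublists', Has τ.2 (S.map fun i => l.getD i 0) ↔ d.Indep S

instance (τ d) : Decidable (MatchesCode τ d) := by unfold MatchesCode; infer_instance

end ConfigType

namespace ConfigTerm

/-- The sum of the signed monomials of a list of terms, as a list of coefficients. -/
def coeffs (ts : List ConfigTerm) : List ℤ :=
  -- The sum of the exponents bounds each of them, so no degree is cut off.
  (List.range ((ts.map fun t => t.2.1).sum + 1)).map fun k =>
    Int.subNatNat (ts.filter fun t => t.1 = false ∧ t.2.1 = k).length
      (ts.filter fun t => t.1 = true ∧ t.2.1 = k).length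

end ConfigTerm

/-- The coefficients of the polynomial part of the expansion. -/
def polyPart (c : PlanarCode) : List ℤ :=
  -- A type without labels has one configuration if it lists the empty set as independent, and none
  -- otherwise.
  ConfigTerm.coeffs ((ConfigType.run c.type).filter fun t => t.2.2.1 = [] ∧ [] ∈ t.2.2.2)

/-- The coefficients of the polynomial with which a hyperfiguration occurs in the expansion. -/
def hyperPart (c d : PlanarCode) : List ℤ :=
  ConfigTerm.coeffs ((ConfigType.run c.type).filter fun t =>
    ¬ t.2.2.1 = [] ∧ t.2.2.MatchesCode d)

/-! ### Primitive recursiveness of the algorithm. -/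

namespace PrimrecPred

variable {α β : Type*} [Primcodable α] [Primcodable β]

theorem forall_mem {l : α → List β} {R : α → β → Prop} (hl : Primrec l)
    (hR : PrimrecPred fun x : α × β => R x.1 x.2) : PrimrecPred fun a => ∀ b ∈ l a, R a b :=
  have h : PrimrecRel fun (b : β) (a : α) => R a b :=
    hR.comp (f := fun x : β × α => (x.2, x.1)) (Primrec.snd.pair Primrec.fst)
  h.forall_mem_list.comp hl Primrec.id

theorem exists_mem {l : α → List β} {R : α → β → Prop} (hl : Primrec l)
    (hR : PrimrecPred fun x : α × β => R x.1 x.2) : PrimrecPred fun a => ∃ b ∈ l a, R a b :=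
  have h : PrimrecRel fun (b : β) (a : α) => R a b :=
    hR.comp (f := fun x : β × α => (x.2, x.1)) (Primrec.snd.pair Primrec.fst)
  h.exists_mem_list.comp hl Primrec.id

end PrimrecPred

namespace Primrec

variable {α β : Type*} [Primcodable α] [Primcodable β]

theorem filter {l : α → List β} {R : α → β → Prop} [∀ a b, Decidable (R a b)] (hl : Primrec l)
    (hR : PrimrecPred fun x : α × β => R x.1 x.2) :
    Primrec fun a => (l a).filter fun b => R a b :=
  have h : PrimrecRel fun (b : β) (a : α) => R a b :=
    hR.comp (f := fun x : β × α => (x.2, x.1)) (Primrec.snd.pair Primrec.fst)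
  letI : DecidableRel fun (b : β) (a : α) => R a b := fun _ _ => inferInstance
  h.listFilter.comp hl Primrec.id

theorem sublists' : Primrec (List.sublists' : List α → List (List α)) := by
  have h : Primrec fun l : List α =>
      l.foldr (fun a s => s ++ s.map fun t => a :: t) [[]] := by
    refine list_foldr (f := fun l : List α => l) (g := fun _ => [[]])
      (h := fun _ (x : α × List (List α)) => x.2 ++ x.2.map fun t => x.1 :: t) .id (.const _) ?_
    refine list_append.comp (snd.comp snd) (list_map (snd.comp snd) ?_)
    exact list_cons.comp (fst.comp (snd.comp fst)) snd
  refine h.of_eq fun l => ?_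
  induction l with
  | nil => rfl
  | cons a l ih => rw [List.foldr_cons, ih, List.sublists'_cons]

theorem list_mem [DecidableEq α] : PrimrecRel fun (a : α) (l : List α) => a ∈ l :=
  (PrimrecPred.exists_mem (l := fun x : α × List α => x.2) (R := fun x b => b = x.1) snd
    (Primrec.eq.comp snd (fst.comp fst))).of_eq fun x => by simp

theorem list_subset [DecidableEq α] : PrimrecRel fun (l m : List α) => l ⊆ m :=
  PrimrecPred.forall_mem (l := fun x : List α × List α => x.1) (R := fun x b => b ∈ x.2) fst
    (list_mem.comp snd (snd.comp fst))

theorem list_sum : Primrec (List.sum : List ℕ → ℕ) := by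
  refine (list_foldr (f := fun l : List ℕ => l) (g := fun _ => 0)
    (h := fun _ x => x.1 + x.2) .id (.const _) ?_).of_eq fun l => ?_
  · exact nat_add.comp (fst.comp snd) (snd.comp snd)
  · rfl

theorem int_subNatNat : Primrec₂ Int.subNatNat := by
  -- Integers are encoded by `n ↦ 2 n` and `-n - 1 ↦ 2 n + 1`.
  have h1 : Primrec Int.ofNat := by
    rw [← Primrec.encode_iff]
    exact (nat_mul.comp (.const 2) .id).of_eq fun n => rfl
  have h2 : Primrec Int.negSucc := by
    rw [← Primrec.encode_iff]
    exact (succ.comp (nat_mul.comp (.const 2) .id)).of_eq fun n => rfl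
  refine (nat_casesOn (f := fun x : ℕ × ℕ => x.2 - x.1) (g := fun x => Int.ofNat (x.1 - x.2))
    (h := fun _ k => Int.negSucc k) (nat_sub.comp snd fst) (h1.comp (nat_sub.comp fst snd))
    (h2.comp snd)).of_eq fun x => ?_
  simp only [Int.subNatNat]
  cases x.2 - x.1 <;> rfl

end Primrec

section Primrec

open Primrec

namespace ConfigType

theorem primrec_has : PrimrecRel Has :=
  PrimrecPred.exists_mem (l := fun x : List (List ℕ) × List ℕ => x.1)
    (R := fun x T => T ⊆ x.2 ∧ x.2 ⊆ T) fst
    ((list_subset.comp snd (snd.comp fst)).and (list_subset.comp (snd.comp fst) snd))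

theorem primrec_cl :
    PrimrecPred fun x : List (List ℕ) × List ℕ × ℕ => Cl x.1 x.2.1 x.2.2 :=
  (list_mem.comp (snd.comp snd) (fst.comp snd)).or
    (primrec_has.comp fst (list_cons.comp (snd.comp snd) (fst.comp snd))).not

theorem primrec_del : Primrec₂ del :=
  Primrec.filter (R := fun (x : List (List ℕ) × ℕ) (S : List ℕ) => ¬ x.2 ∈ S) fst
    (list_mem.comp (snd.comp fst) snd).not

theorem primrec_link : Primrec₂ link :=
  Primrec.filter (R := fun (x : List (List ℕ) × ℕ) (S : List ℕ) => x.2 ∈ S) fst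
    (list_mem.comp (snd.comp fst) snd)

theorem primrec_isFree : PrimrecRel IsFree :=
  PrimrecPred.forall_mem (l := fun x : List (List ℕ) × ℕ => del x.1 x.2)
    (R := fun x S => ¬ Cl x.1 S x.2) primrec_del
    (primrec_cl.comp (f := fun y : (List (List ℕ) × ℕ) × List ℕ => (y.1.1, y.2, y.1.2))
      ((fst.comp fst).pair (snd.pair (snd.comp fst)))).not

theorem primrec_isMeet : PrimrecPred
    fun x : (List (List ℕ) × ℕ) × (List ℕ × List ℕ × List ℕ) => IsMeet x.1.1 x.1.2 x.2 := by
  have hM : Primrec fun x : (List (List ℕ) × ℕ) × (List ℕ × List ℕ × List ℕ) => x.1.1 :=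
    fst.comp fst
  have hp : Primrec fun x : (List (List ℕ) × ℕ) × (List ℕ × List ℕ × List ℕ) => x.1.2 :=
    snd.comp fst
  have h1 : Primrec fun x : (List (List ℕ) × ℕ) × (List ℕ × List ℕ × List ℕ) => x.2.1 :=
    fst.comp snd
  have h2 : Primrec fun x : (List (List ℕ) × ℕ) × (List ℕ × List ℕ × List ℕ) => x.2.2.1 :=
    fst.comp (snd.comp snd)
  have h3 : Primrec fun x : (List (List ℕ) × ℕ) × (List ℕ × List ℕ × List ℕ) => x.2.2.2 :=
    snd.comp (snd.comp snd)
  refine ((primrec_cl.comp (hM.pair (h1.pair hp))).and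
    (primrec_cl.comp (hM.pair (h2.pair hp)))).and
    (((list_subset.comp h3 (list_append.comp h1 h2)).and
      (PrimrecPred.forall_mem (list_append.comp h1 h2) ?_)).and
      (PrimrecPred.forall_mem (primrec_del.comp hM hp) ?_))
  · exact primrec_cl.comp ((hM.comp fst).pair ((h3.comp fst).pair snd))
  · refine (primrec_cl.comp ((hM.comp fst).pair (snd.pair (hp.comp fst)))).not.or
      ((PrimrecPred.forall_mem (h1.comp fst) ?_).or (PrimrecPred.forall_mem (h2.comp fst) ?_)) <;>
    exact primrec_cl.comp ((hM.comp (fst.comp fst)).pair ((snd.comp fst).pair snd))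

theorem primrec_triples : Primrec triples :=
  list_flatMap .id (list_flatMap fst (list_map (fst.comp fst)
    ((snd.comp (fst.comp fst)).pair ((snd.comp fst).pair snd))))

theorem primrec_choices : Primrec choices := by
  have hM : Primrec fun x : ConfigType × ℕ => x.1.2 := snd.comp fst
  refine list_flatMap fst (list_append.comp (Primrec.ite (primrec_isFree.comp hM snd)
    (list_cons.comp (snd.pair (.const 4)) (.const [])) (.const []))
    (list_map (Primrec.filter (primrec_triples.comp (primrec_del.comp hM snd)) ?_) ?_))
  · exact primrec_isMeet.comp (((hM.comp fst).pair (snd.comp fst)).pair snd)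
  · exact (snd.comp fst).pair (nat_sub.comp (nat_add.comp (list_length.comp (fst.comp snd))
      (list_length.comp (fst.comp (snd.comp snd)))) (list_length.comp (snd.comp (snd.comp snd))))

theorem primrec_degenerations : Primrec₂ degenerations := by
  have hM : Primrec fun x : ConfigType × ℕ => x.1.2 := snd.comp fst
  refine list_map (Primrec.filter (sublists'.comp (primrec_link.comp hM snd)) ?_) ?_
  · exact (Primrec.eq.comp snd (primrec_link.comp (hM.comp fst) (snd.comp fst))).not
  · exact (fst.comp (fst.comp fst)).pair
      (list_append.comp (primrec_del.comp (hM.comp fst) (snd.comp fst)) snd)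

theorem primrec_remove : Primrec₂ remove :=
  (Primrec.filter (fst.comp fst) (Primrec.eq.comp snd (snd.comp fst)).not).pair
    (primrec_del.comp (snd.comp fst) snd)

theorem primrec_expandAt : Primrec₂ expandAt :=
  list_append.comp
    (list_map (list_range.comp (snd.comp snd)) ((Primrec.const false).pair
      (snd.pair (primrec_remove.comp (fst.comp fst) (fst.comp (snd.comp fst))))))
    (list_map (primrec_degenerations.comp fst (fst.comp snd))
      ((Primrec.const true).pair ((Primrec.const 0).pair snd)))

theorem primrec_expand : Primrec expand :=
  option_getD.comp (option_map (list_head?.comp primrec_choices) primrec_expandAt)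
    (list_cons.comp ((Primrec.const false).pair ((Primrec.const 0).pair .id)) (.const []))

theorem primrec_step : Primrec step :=
  list_flatMap .id (list_map (primrec_expand.comp (snd.comp (snd.comp snd)))
    (((dom_bool₂ xor).comp (fst.comp (snd.comp fst)) (fst.comp snd)).pair
      ((nat_add.comp (fst.comp (snd.comp (snd.comp fst))) (fst.comp (snd.comp snd))).pair
        (snd.comp (snd.comp snd)))))

theorem primrec_run : Primrec run :=
  nat_iterate (nat_add.comp (list_length.comp fst) (list_length.comp snd))
    (list_cons.comp ((Primrec.const false).pair ((Primrec.const 0).pair .id)) (.const []))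
    (primrec_step.comp snd)

theorem primrec_tuples : Primrec₂ tuples :=
  nat_rec' (f := fun x : List ℕ × ℕ => x.2) (g := fun _ => [[]])
    (h := fun x (y : ℕ × List (List ℕ)) => y.2.flatMap fun l => x.1.map fun a => a :: l) snd
    (.const _) (list_flatMap (snd.comp snd) (list_map (fst.comp (fst.comp fst))
      (list_cons.comp snd (snd.comp fst))))

end ConfigType

theorem PlanarCode.primrec_indep : PrimrecRel PlanarCode.Indep := by
  have hl : Primrec fun x : PlanarCode × List ℕ => x.2.length := list_length.comp snd
  have h1 : PrimrecPred fun x : PlanarCode × List ℕ => ∃ l ∈ x.1.2.1, x.2 ⊆ l :=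
    PrimrecPred.exists_mem (fst.comp (snd.comp fst)) (list_subset.comp (snd.comp fst) snd)
  have h2 : PrimrecPred fun x : PlanarCode × List ℕ => ∃ l ∈ x.1.2.2, x.2 ⊆ l :=
    PrimrecPred.exists_mem (snd.comp (snd.comp fst)) (list_subset.comp (snd.comp fst) snd)
  exact (nat_le.comp hl (.const 2)).or (((Primrec.eq.comp hl (.const 3)).and h1.not).or
    ((Primrec.eq.comp hl (.const 4)).and (h1.not.and h2.not)))

theorem PlanarCode.primrec_type : Primrec PlanarCode.type :=
  (list_range.comp fst).pair
    (Primrec.filter (sublists'.comp (list_range.comp fst)) PlanarCode.primrec_indep)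

theorem ConfigType.primrec_matchesCode : PrimrecRel ConfigType.MatchesCode := by
  refine (Primrec.eq.comp (list_length.comp (fst.comp fst)) (fst.comp snd)).and
    (PrimrecPred.exists_mem (primrec_tuples.comp (fst.comp fst) (fst.comp snd))
      ((PrimrecPred.forall_mem (fst.comp (fst.comp fst)) (list_mem.comp snd (snd.comp fst))).and
        (PrimrecPred.forall_mem
          (sublists'.comp (list_range.comp (fst.comp (snd.comp fst)))) ?_)))
  have h1 : PrimrecPred fun x : ((ConfigType × PlanarCode) × List ℕ) × List ℕ =>
      Has x.1.1.1.2 (x.2.map fun i => x.1.2.getD i 0) :=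
    primrec_has.comp (snd.comp (fst.comp (fst.comp fst)))
      (list_map snd ((list_getD 0).comp (snd.comp (fst.comp fst)) snd))
  have h2 : PrimrecPred fun x : ((ConfigType × PlanarCode) × List ℕ) × List ℕ =>
      x.1.1.2.Indep x.2 := PlanarCode.primrec_indep.comp (snd.comp (fst.comp fst)) snd
  exact ((h1.and h2).or (h1.not.and h2.not)).of_eq fun x =>
    iff_iff_and_or_not_and_not.symm

theorem ConfigTerm.primrec_coeffs : Primrec ConfigTerm.coeffs := by
  have h (b : Bool) : Primrec fun x : List ConfigTerm × ℕ =>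
      (x.1.filter fun t => t.1 = b ∧ t.2.1 = x.2).length :=
    list_length.comp (Primrec.filter (R := fun (x : List ConfigTerm × ℕ) (t : ConfigTerm) =>
        t.1 = b ∧ t.2.1 = x.2) fst
      ((Primrec.eq.comp (fst.comp snd) (.const b)).and
        (Primrec.eq.comp (fst.comp (snd.comp snd)) (snd.comp fst))))
  exact list_map (list_range.comp (succ.comp (list_sum.comp
    (list_map .id (fst.comp (snd.comp snd)))))) (int_subNatNat.comp (h false) (h true))

theorem primrec_polyPart : Primrec polyPart :=
  ConfigTerm.primrec_coeffs.comp (Primrec.filter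
    (ConfigType.primrec_run.comp PlanarCode.primrec_type)
    ((Primrec.eq.comp (fst.comp (snd.comp (snd.comp snd))) (.const [])).and
      (list_mem.comp (.const []) (snd.comp (snd.comp (snd.comp snd))))))

theorem primrec_hyperPart : Primrec₂ hyperPart :=
  ConfigTerm.primrec_coeffs.comp (Primrec.filter
    (ConfigType.primrec_run.comp (PlanarCode.primrec_type.comp fst))
    ((Primrec.eq.comp (fst.comp (snd.comp (snd.comp snd))) (.const [])).not.and
      (ConfigType.primrec_matchesCode.comp (snd.comp (snd.comp snd)) (snd.comp fst))))

end Primrec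

/-! ### Independence and spans of labelled points. -/

section LinearAlgebra

variable {K : Type v} [Field K] {α : Type u} {β : Type w}

/-- Independence of the points with labels in `A`. -/
def Ind (σ : α → ProjSpace3 K) (A : Set α) : Prop := LinearIndepOn K (fun x => (σ x).rep) A

/-- The subspace of `K ^ 4` spanned by the points with labels in `A`. -/
def spanOf (σ : α → ProjSpace3 K) (A : Set α) : Submodule K (Fin 4 → K) :=
  Submodule.span K ((fun x => (σ x).rep) '' A)

theorem Projectivization.submodule_le_iff_rep_mem (x : ProjSpace3 K)
    (W : Submodule K (Fin 4 → K)) : x.submodule ≤ W ↔ x.rep ∈ W := by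
  rw [Projectivization.submodule_eq, Submodule.span_singleton_le_iff_mem]

theorem Ind.mono {σ : α → ProjSpace3 K} {A B : Set α} (h : Ind σ B) (hAB : A ⊆ B) : Ind σ A :=
  LinearIndepOn.mono h hAB

theorem ind_empty (σ : α → ProjSpace3 K) : Ind σ ∅ := linearIndepOn_empty _ _

theorem ind_insert {σ : α → ProjSpace3 K} {A : Set α} {a : α} (ha : a ∉ A) :
    Ind σ (insert a A) ↔ Ind σ A ∧ (σ a).rep ∉ spanOf σ A :=
  linearIndepOn_insert ha

theorem ind_congr {σ ρ : α → ProjSpace3 K} {A : Set α} (h : ∀ x ∈ A, σ x = ρ x) :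
    Ind σ A ↔ Ind ρ A :=
  linearIndepOn_congr fun x hx => by simp only [h x hx]

theorem ind_image {σ : α → ProjSpace3 K} {φ : β → α} (hφ : Function.Injective φ) (A : Set β) :
    Ind σ (φ '' A) ↔ Ind (σ ∘ φ) A :=
  (linearIndependent_equiv (Equiv.Set.image φ A hφ)
    (f := fun x : (φ '' A : Set α) => (σ x).rep)).symm

theorem spanOf_congr {σ ρ : α → ProjSpace3 K} {A : Set α} (h : ∀ x ∈ A, σ x = ρ x) :
    spanOf σ A = spanOf ρ A := by
  unfold spanOf
  congr 1
  exact Set.image_congr fun x hx => by rw [h x hx]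

theorem spanOf_mono (σ : α → ProjSpace3 K) {A B : Set α} (h : A ⊆ B) : spanOf σ A ≤ spanOf σ B :=
  Submodule.span_mono (Set.image_mono h)

theorem rep_mem_spanOf (σ : α → ProjSpace3 K) {A : Set α} {a : α} (h : a ∈ A) :
    (σ a).rep ∈ spanOf σ A :=
  Submodule.subset_span ⟨a, h, rfl⟩

theorem spanOf_le_iff {σ : α → ProjSpace3 K} {A : Set α} {W : Submodule K (Fin 4 → K)} :
    spanOf σ A ≤ W ↔ ∀ a ∈ A, (σ a).rep ∈ W := by
  simp [spanOf, Submodule.span_le, Set.subset_def]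

theorem spanOf_union (σ : α → ProjSpace3 K) (A B : Set α) :
    spanOf σ (A ∪ B) = spanOf σ A ⊔ spanOf σ B := by
  rw [spanOf, Set.image_union, Submodule.span_union]; rfl

theorem Ind.finrank_spanOf {σ : α → ProjSpace3 K} {A : Set α} (h : Ind σ A) :
    Module.finrank K (spanOf σ A) = A.ncard := by
  have hl : LinearIndependent K fun x : A => (σ x).rep := h
  have := hl.finite
  have := Fintype.ofFinite A
  rw [← Nat.card_coe_set_eq, Nat.card_eq_fintype_card, ← finrank_span_eq_card hl, spanOf,
    Set.image_eq_range]

theorem exists_ind_subset (σ : α → ProjSpace3 K) (A : Set α) :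
    ∃ I ⊆ A, Ind σ I ∧ spanOf σ I = spanOf σ A := by
  obtain ⟨b, h1, -, h2, h3⟩ := exists_linearIndepOn_extension
    (linearIndepOn_empty K fun x => (σ x).rep) (Set.empty_subset A)
  refine ⟨b, h1, h3, le_antisymm (spanOf_mono σ h1) ?_⟩
  rw [spanOf_le_iff]
  exact fun a ha => h2 ⟨a, ha, rfl⟩

/-- These points are the image of `ℙ K W` under the inclusion of `W`, so the count for a projective
space of known dimension applies. -/
theorem card_points_of_subspace [Finite K] (W : Submodule K (Fin 4 → K)) :
    Nat.card {x : ProjSpace3 K // x.rep ∈ W} =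
      ∑ i ∈ Finset.range (Module.finrank K W), Nat.card K ^ i := by
  rw [← Projectivization.card_of_finrank K W rfl]
  symm
  refine Nat.card_congr (Equiv.ofBijective
    (fun x => ⟨Projectivization.map W.subtype W.injective_subtype x, ?_⟩) ⟨?_, ?_⟩)
  · induction x using Projectivization.ind with
    | h v hv =>
      rw [Projectivization.map_mk, ← Projectivization.submodule_le_iff_rep_mem,
        Projectivization.submodule_mk, Submodule.span_singleton_le_iff_mem]
      exact v.2
  · intro x y h
    exact Projectivization.map_injective W.subtype W.injective_subtype (congrArg Subtype.val h)
  · rintro ⟨x, hx⟩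
    refine ⟨Projectivization.mk K ⟨x.rep, hx⟩ fun h => x.rep_nonzero (congrArg Subtype.val h), ?_⟩
    apply Subtype.ext
    simp only [Projectivization.map_mk]
    exact x.mk_rep

end LinearAlgebra

theorem Set.Finite.ncard_eq_sum_fiber {S : Type u} {T : Type v} {X : Set S} (hX : X.Finite)
    (f : S → T) (t : Finset T) (h : ∀ x ∈ X, f x ∈ t) :
    X.ncard = ∑ b ∈ t, {a | a ∈ X ∧ f a = b}.ncard := by
  classical
  rw [Set.ncard_eq_toFinset_card X hX, Finset.card_eq_sum_card_fiberwise (f := f) (t := t)]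
  · refine Finset.sum_congr rfl fun b _ => ?_
    rw [← Set.ncard_coe_finset]
    congr 1
    ext a
    simp
  · intro x hx
    exact h x (by simpa using hx)

/-! ### Configurations of a type and their degenerations. -/

namespace ConfigType

theorem Has.congr {M : List (List ℕ)} {A B : List ℕ} (h : Has M A) (hAB : ∀ x, x ∈ A ↔ x ∈ B) :
    Has M B := by
  obtain ⟨T, hT, h1, h2⟩ := h
  exact ⟨T, hT, fun x hx => (hAB x).1 (h1 hx), fun x hx => h2 ((hAB x).2 hx)⟩

theorem has_congr {M : List (List ℕ)} {A B : List ℕ} (hAB : ∀ x, x ∈ A ↔ x ∈ B) :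
    Has M A ↔ Has M B :=
  ⟨fun h => h.congr hAB, fun h => h.congr fun x => (hAB x).symm⟩

theorem has_of_mem {M : List (List ℕ)} {A : List ℕ} (h : A ∈ M) : Has M A :=
  ⟨A, h, fun _ hx => hx, fun _ hx => hx⟩

theorem has_append {M N : List (List ℕ)} {A : List ℕ} : Has (M ++ N) A ↔ Has M A ∨ Has N A := by
  unfold Has
  constructor
  · rintro ⟨T, hT, h⟩
    rcases List.mem_append.1 hT with hT | hT
    · exact .inl ⟨T, hT, h⟩
    · exact .inr ⟨T, hT, h⟩
  · rintro (⟨T, hT, h⟩ | ⟨T, hT, h⟩)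
    · exact ⟨T, List.mem_append_left _ hT, h⟩
    · exact ⟨T, List.mem_append_right _ hT, h⟩

theorem mem_del {M : List (List ℕ)} {p : ℕ} {S : List ℕ} : S ∈ del M p ↔ S ∈ M ∧ p ∉ S := by
  simp [del]

theorem mem_link {M : List (List ℕ)} {p : ℕ} {S : List ℕ} : S ∈ link M p ↔ S ∈ M ∧ p ∈ S := by
  simp [link]

theorem has_del {M : List (List ℕ)} {p : ℕ} {A : List ℕ} :
    Has (del M p) A ↔ Has M A ∧ p ∉ A := by
  constructor
  · rintro ⟨T, hT, h1, h2⟩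
    rw [mem_del] at hT
    exact ⟨⟨T, hT.1, h1, h2⟩, fun h => hT.2 (h2 h)⟩
  · rintro ⟨⟨T, hT, h1, h2⟩, hp⟩
    exact ⟨T, mem_del.2 ⟨hT, fun h => hp (h1 h)⟩, h1, h2⟩

/-- Well-formed types: the independent sets are increasing lists of labels of points, and there are
no repetitions. -/
structure Wf (τ : ConfigType) : Prop where
  nodup_points : τ.1.Nodup
  nodup : τ.2.Nodup
  sorted : ∀ T ∈ τ.2, T.Pairwise (· < ·)
  subset : ∀ T ∈ τ.2, T ⊆ τ.1

/-- This makes the representative of an independent set in a well-formed type unique, although `Has`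
ignores order and repetition. -/
theorem eq_of_sorted {S T : List ℕ} (hS : S.Pairwise (· < ·)) (hT : T.Pairwise (· < ·))
    (h1 : S ⊆ T) (h2 : T ⊆ S) : S = T := by
  have hS' : S.Nodup := hS.imp fun h => ne_of_lt h
  have hT' : T.Nodup := hT.imp fun h => ne_of_lt h
  refine List.Perm.eq_of_pairwise (le := (· < ·)) ?_ hS hT
    ((List.perm_ext_iff_of_nodup hS' hT').2 fun x => ⟨fun h => h1 h, fun h => h2 h⟩)
  intro a b _ _ h h'
  omega

theorem Wf.remove {τ : ConfigType} (h : Wf τ) (p : ℕ) : Wf (remove τ p) := by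
  refine ⟨h.nodup_points.filter _, h.nodup.filter _, fun T hT => ?_, fun T hT x hx => ?_⟩
  · exact h.sorted T (mem_del.1 hT).1
  · obtain ⟨h1, h2⟩ := mem_del.1 hT
    have : x ≠ p := fun e => h2 (e ▸ hx)
    simp [ConfigType.remove, this, h.subset T h1 hx]

theorem Wf.degeneration {τ : ConfigType} (h : Wf τ) {p : ℕ} {N : List (List ℕ)}
    (hN : N.Sublist (link τ.2 p)) : Wf (τ.1, del τ.2 p ++ N) := by
  have key : ∀ T ∈ del τ.2 p ++ N, T ∈ τ.2 := by
    intro T hT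
    rcases List.mem_append.1 hT with hT | hT
    · exact (mem_del.1 hT).1
    · exact (mem_link.1 (hN.subset hT)).1
  refine ⟨h.nodup_points, List.Nodup.append (h.nodup.filter _)
    ((h.nodup.filter _).sublist hN) ?_, fun T hT => h.sorted T (key T hT),
    fun T hT => h.subset T (key T hT)⟩
  intro T h1 h2
  exact (mem_del.1 h1).2 (mem_link.1 (hN.subset h2)).2

variable {K : Type v} [Field K]

/-- The point configuration `σ` has type `τ`. -/
def Realizes (τ : ConfigType) (σ : ℕ → ProjSpace3 K) : Prop :=
  ∀ A : List ℕ, A ⊆ τ.1 → (Has τ.2 A ↔ Ind σ {x | x ∈ A})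

variable (K) in
/-- A point of projective space, the position of the labels which are not in use. -/
noncomputable def base : ProjSpace3 K := Classical.arbitrary _

variable (K) in
/-- The point configurations of type `τ`. -/
def realizations (τ : ConfigType) : Set (ℕ → ProjSpace3 K) :=
  {σ | (∀ x, x ∉ τ.1 → σ x = base K) ∧ Realizes τ σ}

variable (K) in
/-- The number of point configurations of type `τ`. -/
noncomputable def count (τ : ConfigType) : ℕ := (realizations K τ).ncard

variable (K) in
theorem finite_supported [Finite K] (V : List ℕ) :
    {σ : ℕ → ProjSpace3 K | ∀ x, x ∉ V → σ x = base K}.Finite := by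
  have : Finite (ProjSpace3 K) := inferInstance
  have : Finite {x // x ∈ V} := inferInstance
  refine Set.Finite.of_injOn (f := fun σ (x : {x // x ∈ V}) => σ x) (t := Set.univ)
    (fun _ _ => Set.mem_univ _) ?_ Set.finite_univ
  intro σ hσ ρ hρ h
  funext x
  by_cases hx : x ∈ V
  · exact congrFun h ⟨x, hx⟩
  · rw [hσ x hx, hρ x hx]

theorem Realizes.congr {τ : ConfigType} {M : List (List ℕ)} {σ : ℕ → ProjSpace3 K}
    (h : Realizes τ σ) (hM : ∀ T, T ∈ τ.2 ↔ T ∈ M) : Realizes (τ.1, M) σ := by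
  intro A hA
  rw [← h A hA]
  simp only [Has, hM]

variable (K) in
theorem count_congr {V : List ℕ} {M N : List (List ℕ)} (h : ∀ T, T ∈ M ↔ T ∈ N) :
    count K (V, M) = count K (V, N) := by
  unfold count realizations
  congr 1
  ext σ
  exact and_congr_right fun _ =>
    ⟨fun hσ => hσ.congr h, fun hσ => hσ.congr fun T => (h T).symm⟩

variable (K) in
/-- The configurations with the dependencies of `τ` among the points other than `p`, and at least
the dependencies of `τ` in which `p` is involved. -/
def extensions (τ : ConfigType) (p : ℕ) : Set (ℕ → ProjSpace3 K) :=
  {σ | (∀ x, x ∉ τ.1 → σ x = base K) ∧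
    (∀ A : List ℕ, A ⊆ τ.1 → p ∉ A → (Has τ.2 A ↔ Ind σ {x | x ∈ A})) ∧
    ∀ A : List ℕ, A ⊆ τ.1 → p ∈ A → Ind σ {x | x ∈ A} → Has τ.2 A}

theorem finite_extensions [Finite K] (τ : ConfigType) (p : ℕ) : (extensions K τ p).Finite :=
  (finite_supported K τ.1).subset fun _ h => h.1

open Classical in
-- A member of `extensions` can differ from type `τ` only by further dependencies of sets through
-- `p`, so the part of the link that stays independent determines its type.
theorem mem_extensions_and_filter_iff {τ : ConfigType} (hτ : Wf τ) {p : ℕ} {N : List (List ℕ)}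
    (hN : N.Sublist (link τ.2 p)) (σ : ℕ → ProjSpace3 K) :
    (σ ∈ extensions K τ p ∧ (link τ.2 p).filter (fun S => Ind σ {x | x ∈ S}) = N) ↔
      σ ∈ realizations K (τ.1, del τ.2 p ++ N) := by
  have hNp : ∀ {A}, Has N A → p ∈ A := by
    rintro A ⟨T, hT, h1, -⟩
    exact h1 (mem_link.1 (hN.subset hT)).2
  constructor
  · rintro ⟨⟨h0, h1, h2⟩, rfl⟩
    refine ⟨h0, fun A hA => ?_⟩
    rw [has_append, has_del]
    by_cases hp : p ∈ A
    · constructor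
      · rintro (h | ⟨T, hT, h3, h4⟩)
        · exact absurd hp h.2
        · refine Ind.mono (B := {x | x ∈ T}) ?_ fun x hx => h4 hx
          simpa using (List.mem_filter.1 hT).2
      · intro h
        obtain ⟨T, hT, h3, h4⟩ := h2 A hA hp h
        refine .inr ⟨T, List.mem_filter.2 ⟨mem_link.2 ⟨hT, h4 hp⟩, ?_⟩, h3, h4⟩
        exact decide_eq_true (h.mono fun x hx => h3 hx)
    · rw [← h1 A hA hp]
      exact ⟨fun h => h.elim And.left fun h => absurd (hNp h) hp, fun h => .inl ⟨h, hp⟩⟩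
  · rintro ⟨h0, h⟩
    have h' : ∀ A : List ℕ, A ⊆ τ.1 → (Has τ.2 A ∧ p ∉ A ∨ Has N A ↔ Ind σ {x | x ∈ A}) := by
      intro A hA
      rw [← h A hA, has_append, has_del]
    refine ⟨⟨h0, fun A hA hp => ?_, fun A hA hp hi => ?_⟩, ?_⟩
    · rw [← h' A hA]
      exact ⟨fun h => .inl ⟨h, hp⟩, fun h => h.elim And.left fun h => absurd (hNp h) hp⟩
    · rcases (h' A hA).2 hi with h3 | ⟨T, hT, h3⟩
      · exact h3.1
      · exact ⟨T, (mem_link.1 (hN.subset hT)).1, h3⟩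
    · have hnd : (link τ.2 p).Nodup := hτ.nodup.filter _
      have key : ∀ T ∈ link τ.2 p, (T ∈ N ↔ Ind σ {x | x ∈ T}) := by
        intro T hT
        obtain ⟨hT1, hT2⟩ := mem_link.1 hT
        rw [← h' T (hτ.subset T hT1)]
        constructor
        · exact fun h => .inr (has_of_mem h)
        · rintro (h | ⟨S, hS, h3, h4⟩)
          · exact absurd hT2 h.2
          · have : S = T := eq_of_sorted (hτ.sorted S (mem_link.1 (hN.subset hS)).1)
              (hτ.sorted T hT1) h3 h4
            exact this ▸ hS
      symm
      -- Equal members are not enough, as the lists must agree in order. `N` is its own filter,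
      -- hence a sublist of the filtered link, and equal length forces equality.
      have hsub : (N.filter fun S => Ind σ {x | x ∈ S}).Sublist
          ((link τ.2 p).filter fun S => Ind σ {x | x ∈ S}) := hN.filter _
      rw [List.filter_eq_self.2 (fun S hS => by simpa using (key S (hN.subset hS)).1 hS)] at hsub
      refine hsub.eq_of_length (List.Perm.length_eq ?_)
      refine (List.perm_ext_iff_of_nodup (hnd.sublist hN) (hnd.filter _)).2 fun T => ?_
      simp only [List.mem_filter, decide_eq_true_eq]
      exact ⟨fun h => ⟨hN.subset h, (key T (hN.subset h)).1 h⟩, fun h => (key T h.1).2 h.2⟩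

variable (K) in
-- The fibres of the map that records which members of the link stay independent are the
-- realizations of the types on the right. Sublists that no configuration produces contribute zero.
theorem ncard_extensions_eq_sum [Finite K] {τ : ConfigType} (hτ : Wf τ) (p : ℕ) :
    (extensions K τ p).ncard =
      ((link τ.2 p).sublists'.map fun N => count K (τ.1, del τ.2 p ++ N)).sum := by
  classical
  have hnd : (link τ.2 p).Nodup := hτ.nodup.filter _
  rw [(finite_extensions τ p).ncard_eq_sum_fiber
    (fun σ => (link τ.2 p).filter fun S => Ind σ {x | x ∈ S}) (link τ.2 p).sublists'.toFinset,
    ← List.sum_toFinset _ (List.nodup_sublists'.2 hnd)]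
  · refine Finset.sum_congr rfl fun N hN => ?_
    rw [count]
    congr 1
    ext σ
    rw [← mem_extensions_and_filter_iff hτ (by simpa using hN) σ]
    rfl
  · intro σ _
    simp

end ConfigType

/-! ### The positions of one point relative to the others. -/

namespace ConfigType

variable {K : Type v} [Field K]

theorem mem_triples {D : List (List ℕ)} {F : List ℕ × List ℕ × List ℕ} :
    F ∈ triples D ↔ F.1 ∈ D ∧ F.2.1 ∈ D ∧ F.2.2 ∈ D := by
  obtain ⟨a, b, c⟩ := F
  simp only [triples, List.mem_flatMap, List.mem_map, Prod.mk.injEq]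
  constructor
  · rintro ⟨a', ha, b', hb, c', hc, rfl, rfl, rfl⟩
    exact ⟨ha, hb, hc⟩
  · rintro ⟨ha, hb, hc⟩
    exact ⟨a, ha, b, hb, c, hc, rfl, rfl, rfl⟩

theorem mem_choices {τ : ConfigType} {p d : ℕ} :
    (p, d) ∈ choices τ ↔ p ∈ τ.1 ∧ ((IsFree τ.2 p ∧ d = 4) ∨ ∃ F : List ℕ × List ℕ × List ℕ,
      (F.1 ∈ del τ.2 p ∧ F.2.1 ∈ del τ.2 p ∧ F.2.2 ∈ del τ.2 p) ∧ IsMeet τ.2 p F ∧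
        d = F.1.length + F.2.1.length - F.2.2.length) := by
  simp only [choices, List.mem_flatMap, List.mem_append, List.mem_map, List.mem_filter,
    decide_eq_true_eq, mem_triples]
  constructor
  · rintro ⟨p', hp', h | ⟨F, ⟨hF1, hF2⟩, hF⟩⟩
    · split_ifs at h with hfree
      · simp only [List.mem_singleton, Prod.mk.injEq] at h
        obtain ⟨rfl, rfl⟩ := h
        exact ⟨hp', .inl ⟨hfree, rfl⟩⟩
      · simp at h
    · rw [Prod.mk.injEq] at hF
      obtain ⟨rfl, rfl⟩ := hF
      exact ⟨hp', .inr ⟨F, hF1, hF2, rfl⟩⟩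
  · rintro ⟨hp, ⟨h, rfl⟩ | ⟨F, hF1, hF2, rfl⟩⟩
    · exact ⟨p, hp, .inl (by rw [if_pos h]; simp)⟩
    · exact ⟨p, hp, .inr ⟨F, ⟨hF1, hF2⟩, rfl⟩⟩

theorem setOf_mem_cons (p : ℕ) (S : List ℕ) : {x | x ∈ p :: S} = insert p {x | x ∈ S} := by
  ext x
  simp

theorem ind_cons {σ : ℕ → ProjSpace3 K} {p : ℕ} {S : List ℕ} (hp : p ∉ S) :
    Ind σ {x | x ∈ p :: S} ↔ Ind σ {x | x ∈ S} ∧ (σ p).rep ∉ spanOf σ {x | x ∈ S} := by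
  rw [setOf_mem_cons]
  exact ind_insert (A := {x | x ∈ S}) hp

theorem ncard_setOf_mem {S : List ℕ} (hS : S.Pairwise (· < ·)) : {x | x ∈ S}.ncard = S.length := by
  have : {x | x ∈ S} = (S.toFinset : Set ℕ) := by ext x; simp
  rw [this, Set.ncard_coe_finset, List.toFinset_card_of_nodup (hS.imp fun h => ne_of_lt h)]

theorem has_iff_of_mem_realizations_remove {τ : ConfigType} {p : ℕ} {ρ : ℕ → ProjSpace3 K}
    (hρ : Realizes (remove τ p) ρ) {A : List ℕ} (hA : A ⊆ τ.1) (hp : p ∉ A) :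
    Has τ.2 A ↔ Ind ρ {x | x ∈ A} := by
  rw [← hρ A, remove, has_del]
  · exact (and_iff_left hp).symm
  · intro x hx
    have : x ≠ p := fun e => hp (e ▸ hx)
    simp [remove, hA hx, this]

/-- Closures of independent sets are spans. -/
theorem cl_iff {τ : ConfigType} (hτ : Wf τ) {p : ℕ} {ρ : ℕ → ProjSpace3 K}
    (hρ : ∀ A : List ℕ, A ⊆ τ.1 → p ∉ A → (Has τ.2 A ↔ Ind ρ {x | x ∈ A}))
    {S : List ℕ} (hS : S ∈ del τ.2 p) {y : ℕ} (hy : y ∈ τ.1) (hyp : y ≠ p) :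
    Cl τ.2 S y ↔ (ρ y).rep ∈ spanOf ρ {x | x ∈ S} := by
  obtain ⟨hS1, hS2⟩ := mem_del.1 hS
  by_cases hyS : y ∈ S
  · exact ⟨fun _ => rep_mem_spanOf ρ hyS, fun _ => .inl hyS⟩
  · have h1 := (hρ S (hτ.subset S hS1) hS2).1 (has_of_mem hS1)
    have h2 := hρ (y :: S) (List.cons_subset.2 ⟨hy, hτ.subset S hS1⟩) (by
      simp [hS2, hyp.symm])
    rw [ind_cons hyS] at h2
    simp only [Cl, hyS, false_or, h2, h1, true_and, not_not]

/-- Only sets `B ∪ {p}` with `B` independent and avoiding `p` matter: if such a set is not listed,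
then `p` is in the closure of `B`, and dependence means that `x` lies on the span of `B`. -/
theorem update_mem_extensions_iff {τ : ConfigType} (hτ : Wf τ) {p : ℕ} (hp : p ∈ τ.1)
    {ρ : ℕ → ProjSpace3 K} (hρ : ρ ∈ realizations K (remove τ p)) (x : ProjSpace3 K) :
    Function.update ρ p x ∈ extensions K τ p ↔
      ∀ S ∈ del τ.2 p, Cl τ.2 S p → x.rep ∈ spanOf ρ {y | y ∈ S} := by
  obtain ⟨h0, hρ⟩ := hρ
  have hupd : ∀ y, y ≠ p → Function.update ρ p x y = ρ y := fun y hy => by simp [hy]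
  have hind : ∀ A : List ℕ, p ∉ A →
      (Ind (Function.update ρ p x) {y | y ∈ A} ↔ Ind ρ {y | y ∈ A}) := fun A hA =>
    ind_congr fun y hy => hupd y fun e => hA (e ▸ hy)
  have hspan : ∀ A : List ℕ, p ∉ A →
      spanOf (Function.update ρ p x) {y | y ∈ A} = spanOf ρ {y | y ∈ A} := fun A hA =>
    spanOf_congr fun y hy => hupd y fun e => hA (e ▸ hy)
  have hins : ∀ A : List ℕ, p ∉ A → (Ind (Function.update ρ p x) {y | y ∈ p :: A} ↔
      Ind ρ {y | y ∈ A} ∧ x.rep ∉ spanOf ρ {y | y ∈ A}) := fun A hA => by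
    rw [ind_cons hA, hind A hA, hspan A hA, Function.update_self]
  constructor
  · rintro ⟨-, -, h⟩ S hS hcl
    obtain ⟨hS1, hS2⟩ := mem_del.1 hS
    by_contra hx
    have h1 := (has_iff_of_mem_realizations_remove hρ (hτ.subset S hS1) hS2).1 (has_of_mem hS1)
    exact hcl.elim hS2 fun hn => hn (h (p :: S) (List.cons_subset.2 ⟨hp, hτ.subset S hS1⟩)
      (by simp) ((hins S hS2).2 ⟨h1, hx⟩))
  · intro h
    refine ⟨fun y hy => ?_, fun A hA hpA => ?_, fun A hA hpA hi => ?_⟩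
    · rw [hupd y fun e => hy (e ▸ hp)]
      exact h0 y fun hy' => hy (List.mem_filter.1 hy').1
    · rw [hind A hpA, has_iff_of_mem_realizations_remove hρ hA hpA]
    · by_contra hn
      have hB : ∀ y, y ∈ p :: A.filter (fun y => ¬ y = p) ↔ y ∈ A := by
        intro y
        by_cases hy : y = p <;> simp [hy, hpA]
      have hpB : p ∉ A.filter fun y => ¬ y = p := by simp
      have hi' := hi.mono (A := {y | y ∈ p :: A.filter (fun y => ¬ y = p)}) fun y hy => (hB y).1 hy
      rw [hins _ hpB] at hi'
      have hsub : (A.filter fun y => ¬ y = p) ⊆ τ.1 := fun y hy => hA (List.mem_filter.1 hy).1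
      obtain ⟨T, hT, h1, h2⟩ := (has_iff_of_mem_realizations_remove hρ hsub hpB).2 hi'.1
      have hpT : p ∉ T := fun hpT => hpB (h1 hpT)
      refine hi'.2 (spanOf_mono ρ (fun y hy => h1 hy) (h T (mem_del.2 ⟨hT, hpT⟩) (.inr fun hh => ?_)))
      refine hn (hh.congr fun y => ?_)
      rw [← hB y, List.mem_cons, List.mem_cons]
      exact or_congr_right ⟨fun hy => h1 hy, fun hy => h2 hy⟩

/-- The positions of `p` form a subspace of the predicted dimension. -/
theorem exists_submodule_of_mem_choices {τ : ConfigType} (hτ : Wf τ) {p d : ℕ}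
    (h : (p, d) ∈ choices τ) {ρ : ℕ → ProjSpace3 K} (hρ : ρ ∈ realizations K (remove τ p)) :
    ∃ W : Submodule K (Fin 4 → K), Module.finrank K W = d ∧
      ∀ x, Function.update ρ p x ∈ extensions K τ p ↔ x.rep ∈ W := by
  obtain ⟨hp, ⟨hfree, rfl⟩ | ⟨⟨F, G, I⟩, ⟨hF, hG, hI⟩, ⟨⟨hFp, hGp⟩, ⟨hI1, hI2⟩, hmin⟩, rfl⟩⟩ :=
    mem_choices.1 h
  · refine ⟨⊤, by simp, fun x => ?_⟩
    rw [update_mem_extensions_iff hτ hp hρ]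
    exact ⟨fun _ => trivial, fun _ S hS hcl => absurd hcl (hfree S hS)⟩
  · dsimp only at *
    have hhas : ∀ A : List ℕ, A ⊆ τ.1 → p ∉ A → (Has τ.2 A ↔ Ind ρ {x | x ∈ A}) :=
      fun A => has_iff_of_mem_realizations_remove hρ.2
    have hind : ∀ S ∈ del τ.2 p, Ind ρ {x | x ∈ S} ∧
        Module.finrank K (spanOf ρ {x | x ∈ S}) = S.length := by
      intro S hS
      obtain ⟨hS1, hS2⟩ := mem_del.1 hS
      have := (hhas S (hτ.subset S hS1) hS2).1 (has_of_mem hS1)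
      exact ⟨this, by rw [this.finrank_spanOf, ncard_setOf_mem (hτ.sorted S hS1)]⟩
    have hcl : ∀ S ∈ del τ.2 p, ∀ T ∈ del τ.2 p, (∀ y ∈ T, Cl τ.2 S y) →
        spanOf ρ {x | x ∈ T} ≤ spanOf ρ {x | x ∈ S} := by
      intro S hS T hT h
      obtain ⟨hT1, hT2⟩ := mem_del.1 hT
      exact spanOf_le_iff.2 fun y hy => (cl_iff hτ hhas hS (hτ.subset T hT1 hy)
        fun e => hT2 (e ▸ hy)).1 (h y hy)
    -- Since `I` spans the sum of the two spans, Grassmann's formula gives the dimension of their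
    -- intersection; in particular the truncated subtraction in `choices` is exact.
    refine ⟨spanOf ρ {x | x ∈ F} ⊓ spanOf ρ {x | x ∈ G}, ?_, fun x => ?_⟩
    · have h1 := Submodule.finrank_sup_add_finrank_inf_eq (spanOf ρ {x | x ∈ F})
        (spanOf ρ {x | x ∈ G})
      have h2 : spanOf ρ {x | x ∈ F} ⊔ spanOf ρ {x | x ∈ G} = spanOf ρ {x | x ∈ I} := by
        apply le_antisymm
        · exact sup_le (hcl I hI F hF fun y hy => hI2 y (List.mem_append_left _ hy))
            (hcl I hI G hG fun y hy => hI2 y (List.mem_append_right _ hy))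
        · rw [← spanOf_union]
          exact spanOf_mono ρ fun y hy => List.mem_append.1 (hI1 hy)
      rw [h2, (hind F hF).2, (hind G hG).2, (hind I hI).2] at h1
      omega
    · rw [update_mem_extensions_iff hτ hp hρ]
      constructor
      · exact fun h => ⟨h F hF hFp, h G hG hGp⟩
      · rintro ⟨hx1, hx2⟩ S hS hSp
        rcases hmin S hS with h | h | h
        · exact absurd hSp h
        · exact hcl S hS F hF h hx1
        · exact hcl S hS G hG h hx2

/-- Forgetting the position of `p` maps onto configurations of the remaining points, and each fibre
is the point set of a subspace of the same dimension `d`. -/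
theorem ncard_extensions_eq_mul [Finite K] {τ : ConfigType} (hτ : Wf τ) {p d : ℕ}
    (h : (p, d) ∈ choices τ) : (extensions K τ p).ncard =
      (∑ i ∈ Finset.range d, Nat.card K ^ i) * count K (remove τ p) := by
  classical
  have hp := (mem_choices.1 h).1
  have hfin : (realizations K (remove τ p)).Finite :=
    (finite_supported K (remove τ p).1).subset fun _ h => h.1
  -- Forgetting `p` means moving it to the base point, where all unused labels sit.
  rw [(finite_extensions τ p).ncard_eq_sum_fiber (fun σ => Function.update σ p (base K))
    hfin.toFinset]
  · rw [count, Set.ncard_eq_toFinset_card _ hfin, mul_comm, ← smul_eq_mul, ← Finset.sum_const]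
    refine Finset.sum_congr rfl fun ρ hρ => ?_
    have hρ : ρ ∈ realizations K (remove τ p) := by simpa using hρ
    obtain ⟨W, rfl, hW⟩ := exists_submodule_of_mem_choices hτ h hρ
    rw [← card_points_of_subspace, ← Nat.card_coe_set_eq]
    have hρp : ρ p = base K := hρ.1 p (by simp [remove])
    refine Nat.card_congr ⟨fun σ => ⟨σ.1 p, ?_⟩, fun x => ⟨Function.update ρ p x.1, ?_⟩, ?_, ?_⟩
    · obtain ⟨σ, hσ, rfl⟩ := σ
      rw [← hW]
      simpa using hσ
    · refine ⟨(hW _).2 x.2, ?_⟩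
      simp [← hρp]
    · rintro ⟨σ, hσ, rfl⟩
      simp
    · rintro ⟨x, hx⟩
      simp
  · intro σ ⟨h0, h1, h2⟩
    simp only [Set.Finite.mem_toFinset]
    refine ⟨fun x hx => ?_, fun A hA => ?_⟩
    · by_cases hxp : x = p
      · simp [hxp]
      · rw [Function.update_of_ne hxp]
        exact h0 x fun hx' => hx (by simp [remove, hx', hxp])
    · have hA' : ∀ x ∈ A, x ∈ τ.1 ∧ x ≠ p := fun x hx => by simpa [remove] using hA hx
      have hpA : p ∉ A := fun hpA => (hA' p hpA).2 rfl
      rw [remove, has_del, and_iff_left hpA, h1 A (fun x hx => (hA' x hx).1) hpA]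
      exact ind_congr fun x hx => (Function.update_of_ne (hA' x hx).2 _ _).symm

end ConfigType

/-! ### Correctness and termination of the expansion. -/

/-- The value of a term, for given values of `q` and of the numbers of configurations. -/
def ConfigTerm.value (q : ℤ) (f : ConfigType → ℤ) (t : ConfigTerm) : ℤ :=
  (if t.1 then -1 else 1) * q ^ t.2.1 * f t.2.2

namespace ConfigType

variable (K : Type v) [Field K]

/-- Equate the two counts of `extensions`. The full link occurs exactly once among its sublists and
gives `τ` itself; solving for that term puts a minus sign on the degenerations. -/
theorem map_value_sum_expandAt [Finite K] {τ : ConfigType} (hτ : Wf τ) {c : ℕ × ℕ}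
    (h : c ∈ choices τ) : ((expandAt τ c).map
      (ConfigTerm.value (Nat.card K) fun g => (count K g : ℤ))).sum = count K τ := by
  obtain ⟨p, d⟩ := c
  have h1 := ncard_extensions_eq_sum K hτ p
  rw [ncard_extensions_eq_mul hτ h] at h1
  have hnd : (link τ.2 p).Nodup := hτ.nodup.filter _
  have hnd' := List.nodup_sublists'.2 hnd
  have hperm : (link τ.2 p).sublists'.Perm
      (link τ.2 p :: (link τ.2 p).sublists'.filter fun N => ¬ N = link τ.2 p) := by
    refine (List.perm_ext_iff_of_nodup hnd' (List.nodup_cons.2 ⟨by simp, hnd'.filter _⟩)).2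
      fun N => ?_
    by_cases hN : N = link τ.2 p <;> simp [hN]
  rw [(hperm.map _).sum_eq, List.map_cons, List.sum_cons] at h1
  have h2 : count K (τ.1, del τ.2 p ++ link τ.2 p) = count K τ :=
    count_congr K fun T => by
      rw [List.mem_append, mem_del, mem_link]
      tauto
  have h3 : ((degenerations τ p).map fun g => (count K g : ℤ)).sum =
      ((((link τ.2 p).sublists'.filter fun N => ¬ N = link τ.2 p).map
        fun N => count K (τ.1, del τ.2 p ++ N)).sum : ℕ) := by
    simp only [degenerations, List.map_map, Nat.cast_list_sum]
    rfl
  have h4 : (((degenerations τ p).map fun g => ((true, 0, g) : ConfigTerm)).map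
      (ConfigTerm.value (Nat.card K) fun g => (count K g : ℤ))).sum =
      - ((degenerations τ p).map fun g => (count K g : ℤ)).sum := by
    rw [List.map_map, List.sum_neg, List.map_map]
    congr 2
    funext g
    simp [ConfigTerm.value]
  have h5 : (((List.range d).map fun i => ((false, i, remove τ p) : ConfigTerm)).map
      (ConfigTerm.value (Nat.card K) fun g => (count K g : ℤ))).sum =
      (((∑ i ∈ Finset.range d, Nat.card K ^ i) * count K (remove τ p) : ℕ) : ℤ) := by
    rw [List.map_map, Finset.sum_mul, Nat.cast_sum, Finset.sum_range]
    rw [← List.sum_ofFn, List.ofFn_eq_map, ← List.map_coe_finRange_eq_range, List.map_map]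
    congr 2
    funext i
    simp [ConfigTerm.value]
  rw [expandAt, List.map_append, List.sum_append, h4, h5, h3, h1, h2]
  push_cast
  ring

theorem map_value_sum_expand [Finite K] {τ : ConfigType} (hτ : Wf τ) :
    ((expand τ).map (ConfigTerm.value (Nat.card K) fun g => (count K g : ℤ))).sum =
      count K τ := by
  rw [expand]
  cases h : (choices τ).head? with
  | none => simp [ConfigTerm.value]
  | some c => exact map_value_sum_expandAt K hτ (List.mem_of_mem_head? h)

theorem map_value_sum_step [Finite K] {ts : List ConfigTerm} (h : ∀ t ∈ ts, Wf t.2.2) :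
    ((step ts).map (ConfigTerm.value (Nat.card K) fun g => (count K g : ℤ))).sum =
      (ts.map (ConfigTerm.value (Nat.card K) fun g => (count K g : ℤ))).sum := by
  induction ts with
  | nil => rfl
  | cons t ts ih =>
    rw [step, List.flatMap_cons, List.map_append, List.sum_append, ← step,
      ih fun s hs => h s (List.mem_cons_of_mem _ hs), List.map_cons, List.sum_cons]
    congr 1
    rw [ConfigTerm.value, ← map_value_sum_expand K (h t List.mem_cons_self), List.map_map,
      ← List.sum_map_mul_left]
    congr 2
    funext u
    obtain ⟨a, i, τ⟩ := t
    obtain ⟨b, j, g⟩ := u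
    cases a <;> cases b <;> simp [ConfigTerm.value, pow_add] <;> ring

/-- The number by which the length of the expansion of a type is bounded. -/
def measure (τ : ConfigType) : ℕ := τ.1.length + τ.2.length

/-- Removal loses a label and degeneration loses an independent set, which gives termination. Labels
are never added, which bounds the size of the hyperfigurations that occur. -/
theorem of_mem_expand {τ : ConfigType} (hτ : Wf τ) {t : ConfigTerm} (ht : t ∈ expand τ) :
    Wf t.2.2 ∧ t.2.2.1.length ≤ τ.1.length ∧
      ((t.2.2 = τ ∧ choices τ = []) ∨ t.2.2.measure < τ.measure) := by
  rw [expand] at ht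
  cases h : (choices τ).head? with
  | none =>
    simp only [h, Option.map_none, Option.getD_none, List.mem_singleton] at ht
    subst ht
    exact ⟨hτ, le_rfl, .inl ⟨rfl, List.head?_eq_none_iff.1 h⟩⟩
  | some c =>
    obtain ⟨p, d⟩ := c
    have hp := (mem_choices.1 (List.mem_of_mem_head? h)).1
    have hdl : (del τ.2 p).length + (link τ.2 p).length = τ.2.length := by
      have := List.length_eq_length_filter_add (l := τ.2) (fun S => decide (p ∈ S))
      simp only [del, link, this, decide_not]
      omega
    simp only [h, Option.map_some, Option.getD_some, expandAt, List.mem_append, List.mem_map,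
      degenerations, List.mem_filter, List.mem_sublists', decide_eq_true_eq] at ht
    rcases ht with ⟨i, -, rfl⟩ | ⟨g, ⟨N, ⟨hN, hne⟩, rfl⟩, rfl⟩
    · have hlt : (remove τ p).1.length < τ.1.length := by
        rw [remove, List.length_filter_lt_length_iff_exists]
        exact ⟨p, hp, by simp⟩
      refine ⟨hτ.remove p, hlt.le, .inr ?_⟩
      have : (remove τ p).2.length ≤ τ.2.length := List.length_filter_le _ _
      simp only [measure]
      omega
    · refine ⟨hτ.degeneration hN, le_rfl, .inr ?_⟩
      have h1 : N.length ≠ (link τ.2 p).length := fun e => hne (hN.eq_of_length e)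
      have h2 := hN.length_le
      simp only [measure, List.length_append]
      omega

/-- Invariant of the rounds: the value is constant, and after `m` rounds a type is terminal or its
measure has dropped by at least `m`. -/
theorem iterate_step_spec [Finite K] {τ : ConfigType} (hτ : Wf τ) (m : ℕ) :
    ((step^[m] [(false, 0, τ)]).map
        (ConfigTerm.value (Nat.card K) fun g => (count K g : ℤ))).sum = count K τ ∧
      ∀ t ∈ step^[m] [(false, 0, τ)], Wf t.2.2 ∧ t.2.2.1.length ≤ τ.1.length ∧
        (choices t.2.2 = [] ∨ t.2.2.measure + m ≤ τ.measure) := by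
  induction m with
  | zero => simp [ConfigTerm.value, hτ]
  | succ m ih =>
    rw [Function.iterate_succ_apply', map_value_sum_step K fun t ht => (ih.2 t ht).1]
    refine ⟨ih.1, fun t ht => ?_⟩
    simp only [step, List.mem_flatMap, List.mem_map] at ht
    obtain ⟨s, hs, u, hu, rfl⟩ := ht
    obtain ⟨h1, h2, h3⟩ := ih.2 s hs
    obtain ⟨h4, h5, h6⟩ := of_mem_expand h1 hu
    refine ⟨h4, h5.trans h2, ?_⟩
    rcases h6 with ⟨h6, h7⟩ | h6
    · exact .inl (by rw [h6, h7])
    · rcases h3 with h3 | h3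
      · simp only [expand, h3, List.head?_nil, Option.map_none, Option.getD_none,
          List.mem_singleton] at hu
        subst hu
        exact .inl h3
      · exact .inr (by simp only; omega)

theorem choices_eq_nil_of_measure_eq_zero {τ : ConfigType} (h : τ.measure = 0) :
    choices τ = [] := by
  have : τ.1 = [] := List.length_eq_zero_iff.1 (by simp only [measure] at h; omega)
  simp [choices, this]

/-- After as many rounds as the measure, a type not yet known to be terminal has measure zero, hence
no labels and no choices. -/
theorem run_spec [Finite K] {τ : ConfigType} (hτ : Wf τ) :
    ((run τ).map (ConfigTerm.value (Nat.card K) fun g => (count K g : ℤ))).sum = count K τ ∧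
      ∀ t ∈ run τ, Wf t.2.2 ∧ t.2.2.1.length ≤ τ.1.length ∧ choices t.2.2 = [] := by
  obtain ⟨h1, h2⟩ := iterate_step_spec K hτ τ.measure
  refine ⟨h1, fun t ht => ?_⟩
  obtain ⟨h3, h4, h5 | h5⟩ := h2 t ht
  · exact ⟨h3, h4, h5⟩
  · exact ⟨h3, h4, choices_eq_nil_of_measure_eq_zero (by omega)⟩

end ConfigType

/-! ### Coefficient lists and polynomials. -/

namespace ConfigTerm

theorem polyOfCoeffs_coeff (l : List ℤ) (n : ℕ) : (polyOfCoeffs l).coeff n = l.getD n 0 := by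
  induction l generalizing n with
  | nil => simp [polyOfCoeffs]
  | cons a l ih =>
    rw [polyOfCoeffs, List.foldr_cons, ← polyOfCoeffs]
    cases n with
    | zero => simp
    | succ n => rw [coeff_add, coeff_C_succ, zero_add, coeff_X_mul, ih, List.getD_cons_succ]

/-- The signed monomial of a term. -/
noncomputable def monomial (t : ConfigTerm) : ℤ[X] := (if t.1 then -1 else 1) * X ^ t.2.1

theorem polyOfCoeffs_coeffs (ts : List ConfigTerm) :
    polyOfCoeffs (coeffs ts) = (ts.map monomial).sum := by
  ext n
  have key : (ts.map monomial).sum.coeff n =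
      Int.subNatNat (ts.filter fun t => t.1 = false ∧ t.2.1 = n).length
        (ts.filter fun t => t.1 = true ∧ t.2.1 = n).length := by
    rw [Int.subNatNat_eq_coe]
    induction ts with
    | nil => simp
    | cons t ts ih =>
      rw [List.map_cons, List.sum_cons, coeff_add, ih]
      obtain ⟨a, i, τ⟩ := t
      by_cases hi : i = n
      · subst hi
        cases a <;> simp [monomial] <;> ring
      · cases a <;> simp [monomial, coeff_X_pow, hi, Ne.symm hi]
  rw [polyOfCoeffs_coeff, coeffs, key]
  by_cases hn : n < (ts.map fun t => t.2.1).sum + 1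
  · rw [List.getD_eq_getElem _ _ (by simpa using hn)]
    simp
  · rw [List.getD_eq_default _ _ (by simpa using Nat.le_of_not_lt hn)]
    -- Beyond the end of the list the default coefficient 0 is right, since each exponent is at most
    -- the sum of all.
    have hne : ∀ t ∈ ts, t.2.1 ≠ n := by
      rintro t ht rfl
      exact hn (Nat.lt_succ_of_le (List.single_le_sum (by simp) _ (List.mem_map_of_mem ht)))
    have h0 (b : Bool) : (ts.filter fun t => t.1 = b ∧ t.2.1 = n) = [] := by
      rw [List.filter_eq_nil_iff]
      intro t ht
      simp [hne t ht]
    rw [h0, h0]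
    rfl

theorem eval_monomial (q : ℤ) (f : ConfigType → ℤ) (t : ConfigTerm) :
    (monomial t).eval q * f t.2.2 = t.value q f := by
  obtain ⟨a, i, τ⟩ := t
  cases a <;> simp [monomial, value]

end ConfigTerm

/-! ### Incidence with lines and planes as rank conditions. -/

section LinearAlgebra

variable {K : Type v} [Field K] {α : Type u}

theorem exists_le_finrank_eq {W : Submodule K (Fin 4 → K)} {k : ℕ}
    (h : Module.finrank K W ≤ k) (hk : k ≤ 4) :
    ∃ W' : Submodule K (Fin 4 → K), W ≤ W' ∧ Module.finrank K W' = k := by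
  induction k, h using Nat.le_induction with
  | base => exact ⟨W, le_rfl, rfl⟩
  | succ k _ ih =>
    obtain ⟨U, hU, hU'⟩ := ih (by omega)
    have hne : U ≠ ⊤ := by
      rintro rfl
      simp at hU'
      omega
    obtain ⟨v, -, hv⟩ := SetLike.exists_of_lt hne.lt_top
    refine ⟨U ⊔ K ∙ v, hU.trans le_sup_left, ?_⟩
    have h0 : v ≠ 0 := fun h => hv (h ▸ U.zero_mem)
    have h1 := Submodule.finrank_sup_add_finrank_inf_eq U (K ∙ v)
    have h2 : U ⊓ K ∙ v = ⊥ := by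
      rw [← disjoint_iff]
      exact (Submodule.disjoint_span_singleton' h0).2 hv
    rw [h2, finrank_bot, finrank_span_singleton h0] at h1
    omega

/-- A span of too small a dimension can be enlarged, so the exact dimension in `InProjLine` and
`InProjPlane` amounts to an upper bound on the rank. -/
theorem exists_finrank_eq_iff {ρ : α → ProjSpace3 K} {S : Set α} {k : ℕ} (hk : k ≤ 4) :
    (∃ W : Submodule K (Fin 4 → K), Module.finrank K W = k ∧
      ∀ x ∈ ρ '' S, x.submodule ≤ W) ↔ Module.finrank K (spanOf ρ S) ≤ k := by
  simp only [Set.forall_mem_image, Projectivization.submodule_le_iff_rep_mem]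
  constructor
  · rintro ⟨W, rfl, hW⟩
    exact Submodule.finrank_mono (spanOf_le_iff.2 fun a ha => hW ha)
  · intro h
    obtain ⟨W, hW, hW'⟩ := exists_le_finrank_eq h hk
    exact ⟨W, hW', fun a ha => hW (rep_mem_spanOf ρ ha)⟩

theorem inProjLine_image_iff {ρ : α → ProjSpace3 K} {S : Set α} :
    InProjLine (ρ '' S) ↔ Module.finrank K (spanOf ρ S) ≤ 2 :=
  exists_finrank_eq_iff (by norm_num)

theorem inProjPlane_image_iff {ρ : α → ProjSpace3 K} {S : Set α} :
    InProjPlane (ρ '' S) ↔ Module.finrank K (spanOf ρ S) ≤ 3 :=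
  exists_finrank_eq_iff (by norm_num)

theorem Ind.finite {ρ : α → ProjSpace3 K} {S : Set α} (h : Ind ρ S) : S.Finite :=
  LinearIndependent.finite (R := K) (f := fun x : S => (ρ x).rep) h

theorem Ind.encard {ρ : α → ProjSpace3 K} {S : Set α} (h : Ind ρ S) :
    S.encard = Module.finrank K (spanOf ρ S) := by
  rw [h.finrank_spanOf, h.finite.cast_ncard_eq]

theorem Ind.encard_le {ρ : α → ProjSpace3 K} {S : Set α} (h : Ind ρ S) : S.encard ≤ 4 := by
  rw [h.encard]
  have := Submodule.finrank_le (spanOf ρ S)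
  simp only [Module.finrank_fintype_fun_eq_card, Fintype.card_fin] at this
  exact_mod_cast this

/-- If the rank exceeds `k`, a basis of the span chosen inside `S` has a subset of `k + 1` points.
-/
theorem finrank_spanOf_le_iff {ρ : α → ProjSpace3 K} {S : Set α} {k : ℕ} :
    Module.finrank K (spanOf ρ S) ≤ k ↔ ∀ T ⊆ S, T.encard = (k + 1 : ℕ) → ¬ Ind ρ T := by
  constructor
  · intro h T hT hc hi
    rw [hi.encard, Nat.cast_inj] at hc
    have := Submodule.finrank_mono (spanOf_mono ρ hT)
    omega
  · intro h
    by_contra! hk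
    obtain ⟨I, hIS, hI, hI'⟩ := exists_ind_subset ρ S
    have h1 := hI.encard
    rw [hI'] at h1
    obtain ⟨T, hT, hT'⟩ := Set.exists_subset_encard_eq (s := I) (k := ((k + 1 : ℕ) : ℕ∞)) (by
      rw [h1]; exact_mod_cast hk)
    exact h T (hT.trans hIS) hT' (hI.mono hT)

theorem ind_iff_of_encard_eq {ρ : α → ProjSpace3 K} {S : Set α} {k : ℕ}
    (hS : S.encard = (k + 1 : ℕ)) : Ind ρ S ↔ ¬ Module.finrank K (spanOf ρ S) ≤ k := by
  have hfin : S.Finite := Set.finite_of_encard_eq_coe hS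
  rw [finrank_spanOf_le_iff]
  push Not
  constructor
  · exact fun h => ⟨S, subset_rfl, hS, h⟩
  · rintro ⟨T, hT, hT', h⟩
    obtain rfl := (hfin.subset hT).eq_of_subset_of_encard_le hT (by rw [hS, hT'])
    exact h

theorem ind_pair_iff {ρ : α → ProjSpace3 K} {a b : α} (h : a ≠ b) :
    Ind ρ {a, b} ↔ ρ a ≠ ρ b := by
  rw [← Projectivization.linearIndependent_pair_iff_ne, Ind, LinearIndepOn.pair_iff _ h,
    LinearIndependent.pair_iff]

theorem ind_of_encard_le_two {ρ : α → ProjSpace3 K} (hρ : Function.Injective ρ) {S : Set α}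
    (hS : S.encard ≤ 2) : Ind ρ S := by
  by_cases hsub : S.Subsingleton
  · obtain rfl | ⟨a, rfl⟩ := hsub.eq_empty_or_singleton
    · exact ind_empty ρ
    · exact LinearIndepOn.singleton (ρ a).rep_nonzero
  · rw [Set.not_subsingleton_iff] at hsub
    obtain ⟨a, ha, b, hb, hab⟩ := hsub
    have : ({a, b} : Set α) = S := by
      refine Set.Finite.eq_of_subset_of_encard_le ?_ (Set.pair_subset ha hb) ?_
      · exact Set.toFinite _
      · rw [Set.encard_pair hab]; exact hS
    rw [← this, ind_pair_iff hab]
    exact fun h => hab (hρ h)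

end LinearAlgebra

/-! ### Planar spaces through their independent sets. -/

namespace PlanarSpace

variable {P : Type u} {Q : Type v}

theorem Collinear.mono {f : PlanarSpace P} {S T : Set P} (h : f.Collinear T) (hST : S ⊆ T) :
    f.Collinear S := by
  rcases h with h | ⟨L, hL, h⟩
  · exact .inl (h.anti hST)
  · exact .inr ⟨L, hL, hST.trans h⟩

theorem Coplanar.mono {f : PlanarSpace P} {S T : Set P} (h : f.Coplanar T) (hST : S ⊆ T) :
    f.Coplanar S := by
  rcases h with h | ⟨H, hH, h⟩
  · exact .inl (h.mono hST)
  · exact .inr ⟨H, hH, hST.trans h⟩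

/-- Two distinct points of `S` fix a line, and by uniqueness the line of any triple containing both
is the same one. -/
theorem collinear_iff_forall_encard_eq {f : PlanarSpace P} {S : Set P} :
    f.Collinear S ↔ ∀ T ⊆ S, T.encard = 3 → f.Collinear T := by
  refine ⟨fun h T hT _ => h.mono hT, fun h => ?_⟩
  by_cases hsub : S.Subsingleton
  · exact .inl hsub
  obtain ⟨a, ha, b, hb, hab⟩ := Set.not_subsingleton_iff.1 hsub
  obtain ⟨L, ⟨hL, haL, hbL⟩, huniq⟩ := f.existsUnique_line a b hab
  refine .inr ⟨L, hL, fun c hc => ?_⟩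
  by_cases hca : c = a
  · exact hca ▸ haL
  by_cases hcb : c = b
  · exact hcb ▸ hbL
  rcases h {a, b, c} (by simp [Set.insert_subset_iff, ha, hb, hc])
    (Set.encard_eq_three.2 ⟨a, b, c, hab, Ne.symm hca, Ne.symm hcb, rfl⟩) with h | ⟨L', hL', h⟩
  · exact absurd (h (by simp) (by simp)) hab
  · have := huniq L' ⟨hL', h (by simp), h (by simp)⟩
    exact this ▸ h (by simp)

/-- A non-collinear triple in `S` fixes a plane. A quadruple containing the triple is not collinear,
so its plane is that one. -/
theorem coplanar_iff_forall_encard_eq {f : PlanarSpace P} {S : Set P} :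
    f.Coplanar S ↔ ∀ T ⊆ S, T.encard = 4 → f.Coplanar T := by
  refine ⟨fun h T hT _ => h.mono hT, fun h => ?_⟩
  by_cases hcol : f.Collinear S
  · exact .inl hcol
  rw [collinear_iff_forall_encard_eq] at hcol
  push Not at hcol
  obtain ⟨T, hTS, hT3, hT⟩ := hcol
  obtain ⟨a, b, c, hab, hac, hbc, rfl⟩ := Set.encard_eq_three.1 hT3
  obtain ⟨H, ⟨hH, haH, hbH, hcH⟩, huniq⟩ := f.existsUnique_plane a b c hab hac hbc (by
    rintro ⟨L, hL, h1, h2, h3⟩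
    exact hT (.inr ⟨L, hL, by simp [Set.insert_subset_iff, h1, h2, h3]⟩))
  refine .inr ⟨H, hH, fun d hd => ?_⟩
  by_cases hdT : d ∈ ({a, b, c} : Set P)
  · rcases hdT with rfl | rfl | rfl <;> assumption
  · rcases h (insert d {a, b, c}) (Set.insert_subset hd hTS)
      (by rw [Set.encard_insert_of_notMem hdT, hT3]; rfl) with h | ⟨H', hH', h⟩
    · exact absurd (h.mono (Set.subset_insert _ _)) hT
    · have := huniq H' ⟨hH', h (by simp), h (by simp), h (by simp)⟩
      exact this ▸ h (by simp)

/-- Independent sets of points: sets of at most two points, non-collinear sets of three points, and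
non-coplanar sets of four points. -/
def Indep (f : PlanarSpace P) (S : Set P) : Prop :=
  S.encard ≤ 2 ∨ (S.encard = 3 ∧ ¬ f.Collinear S) ∨ (S.encard = 4 ∧ ¬ f.Coplanar S)

theorem indep_iff_of_encard_eq_three {f : PlanarSpace P} {S : Set P} (h : S.encard = 3) :
    f.Indep S ↔ ¬ f.Collinear S := by
  simp [Indep, h, show ¬ (3 : ℕ∞) ≤ 2 by decide]

theorem indep_iff_of_encard_eq_four {f : PlanarSpace P} {S : Set P} (h : S.encard = 4) :
    f.Indep S ↔ ¬ f.Coplanar S := by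
  simp [Indep, h, show ¬ (4 : ℕ∞) ≤ 2 by decide]

theorem collinear_iff_indep {f : PlanarSpace P} {S : Set P} :
    f.Collinear S ↔ ∀ T ⊆ S, T.encard = 3 → ¬ f.Indep T := by
  rw [collinear_iff_forall_encard_eq]
  refine forall₃_congr fun T _ h => ?_
  rw [indep_iff_of_encard_eq_three h, not_not]

theorem coplanar_iff_indep {f : PlanarSpace P} {S : Set P} :
    f.Coplanar S ↔ ∀ T ⊆ S, T.encard = 4 → ¬ f.Indep T := by
  rw [coplanar_iff_forall_encard_eq]
  refine forall₃_congr fun T _ h => ?_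
  rw [indep_iff_of_encard_eq_four h, not_not]

theorem iso_of_indep_iff {f : PlanarSpace P} {g : PlanarSpace Q} (e : P ≃ Q)
    (h : ∀ S, g.Indep (e '' S) ↔ f.Indep S) : f.Iso g := by
  have key : ∀ (S : Set P) (k : ℕ∞), (∀ T ⊆ e '' S, T.encard = k → ¬ g.Indep T) ↔
      ∀ T ⊆ S, T.encard = k → ¬ f.Indep T := by
    intro S k
    constructor
    · intro h' T hT hk
      rw [← h]
      exact h' _ (Set.image_mono hT) (by rw [e.injective.encard_image, hk])
    · intro h' T hT hk
      obtain ⟨T, hTS, rfl⟩ := Set.subset_image_iff.1 hT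
      rw [h]
      exact h' T hTS (by rw [← hk, e.injective.encard_image])
  exact ⟨e, fun S => by rw [collinear_iff_indep, collinear_iff_indep, key],
    fun S => by rw [coplanar_iff_indep, coplanar_iff_indep, key]⟩

theorem Iso.exists_indep_iff {f : PlanarSpace P} {g : PlanarSpace Q} (h : f.Iso g) :
    ∃ e : P ≃ Q, ∀ S, g.Indep (e '' S) ↔ f.Indep S := by
  obtain ⟨e, h1, h2⟩ := h
  refine ⟨e, fun S => ?_⟩
  simp only [Indep, h1, h2, e.injective.encard_image]

variable {K : Type v} [Field K]

/-- Up to two points, independence is injectivity; for three and four points it is the failure of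
the rank bound for a line or a plane. Larger independent sets do not exist in `K ^ 4`. -/
theorem indep_iff_ind_of_strong {f : PlanarSpace P} (ρ : f.StrongRealization K) (S : Set P) :
    f.Indep S ↔ Ind ρ.toFun S := by
  constructor
  · rintro (h | ⟨h, h'⟩ | ⟨h, h'⟩)
    · exact ind_of_encard_le_two ρ.injective h
    · rwa [ind_iff_of_encard_eq (k := 2) h, ← inProjLine_image_iff, ρ.line_iff]
    · rwa [ind_iff_of_encard_eq (k := 3) h, ← inProjPlane_image_iff, ρ.plane_iff]
  · intro h
    have h1 := h.encard
    have h2 := h.encard_le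
    rw [h1] at h2
    have h3 : Module.finrank K (spanOf ρ.toFun S) ≤ 4 := by exact_mod_cast h2
    have h4 : Module.finrank K (spanOf ρ.toFun S) ≤ 2 ∨ Module.finrank K (spanOf ρ.toFun S) = 3 ∨
      Module.finrank K (spanOf ρ.toFun S) = 4 := by omega
    rcases h4 with h4 | h4 | h4
    · exact .inl (by rw [h1]; exact_mod_cast h4)
    · have h5 : S.encard = 3 := by rw [h1, h4]; rfl
      rw [indep_iff_of_encard_eq_three h5, ← ρ.line_iff, inProjLine_image_iff, h4]
      norm_num
    · have h5 : S.encard = 4 := by rw [h1, h4]; rfl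
      rw [indep_iff_of_encard_eq_four h5, ← ρ.plane_iff, inProjPlane_image_iff, h4]
      norm_num

/-- A map with the right independent sets is a strong realization. -/
def strongRealizationOfIndep {f : PlanarSpace P} (ρ : P → ProjSpace3 K)
    (h : ∀ S, f.Indep S ↔ Ind ρ S) : f.StrongRealization K where
  toFun := ρ
  injective a b hab := by
    by_contra hne
    have := (h {a, b}).1 (.inl (by rw [Set.encard_pair hne]))
    exact (ind_pair_iff hne).1 this hab
  line_iff S := by
    rw [inProjLine_image_iff, finrank_spanOf_le_iff, collinear_iff_indep]
    simp only [h]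
    rfl
  plane_iff S := by
    rw [inProjPlane_image_iff, finrank_spanOf_le_iff, coplanar_iff_indep]
    simp only [h]
    rfl

end PlanarSpace

/-! ### Types of planar spaces. -/

namespace ConfigType

variable {P : Type u} {Q : Type w}

/-- The labelling `φ` of the points of `f` identifies `τ` with the type of `f`. -/
structure IsLabelling (τ : ConfigType) (f : PlanarSpace P) (φ : P → ℕ) : Prop where
  injective : Function.Injective φ
  mem_iff : ∀ x, x ∈ τ.1 ↔ x ∈ Set.range φ
  has_iff : ∀ A : List ℕ, A ⊆ τ.1 → (Has τ.2 A ↔ f.Indep (φ ⁻¹' {x | x ∈ A}))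

/-- `τ` is the type of the planar space `f`, up to labelling. -/
def Matches (τ : ConfigType) (f : PlanarSpace P) : Prop := ∃ φ, IsLabelling τ f φ

theorem IsLabelling.exists_list {τ : ConfigType} {f : PlanarSpace P} {φ : P → ℕ}
    (h : IsLabelling τ f φ) (S : Set P) : ∃ A : List ℕ, A ⊆ τ.1 ∧ φ ⁻¹' {x | x ∈ A} = S := by
  classical
  refine ⟨τ.1.filter fun x => x ∈ φ '' S, List.filter_subset_self _, ?_⟩
  ext p
  have : φ p ∈ τ.1 := (h.mem_iff _).2 ⟨p, rfl⟩
  simp [this, h.injective.eq_iff]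

theorem Matches.of_iso {τ : ConfigType} {f : PlanarSpace P} {g : PlanarSpace Q}
    (h : Matches τ f) (hfg : f.Iso g) : Matches τ g := by
  obtain ⟨φ, h1, h2, h3⟩ := h
  obtain ⟨e, he⟩ := hfg.exists_indep_iff
  refine ⟨φ ∘ e.symm, h1.comp e.symm.injective, fun x => ?_, fun A hA => ?_⟩
  · rw [h2, EquivLike.range_comp]
  · rw [h3 A hA, ← he, Equiv.image_eq_preimage_symm, Set.preimage_comp]

/-- Two labellings by the same labels differ by a bijection of the points, and both read
independence off `τ`. -/
theorem Matches.iso {τ : ConfigType} {f : PlanarSpace P} {g : PlanarSpace Q}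
    (h : Matches τ f) (h' : Matches τ g) : f.Iso g := by
  obtain ⟨φ, h⟩ := h
  obtain ⟨ψ, h'⟩ := h'
  have hex : ∀ p, ∃ q, ψ q = φ p := fun p => (h'.mem_iff _).1 ((h.mem_iff _).2 ⟨p, rfl⟩)
  choose e he using hex
  have hbij : Function.Bijective e := by
    constructor
    · intro a b hab
      apply h.injective
      rw [← he a, ← he b, hab]
    · intro q
      obtain ⟨p, hp⟩ := (h.mem_iff (ψ q)).1 ((h'.mem_iff _).2 ⟨q, rfl⟩)
      exact ⟨p, h'.injective (by rw [he, hp])⟩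
  refine PlanarSpace.iso_of_indep_iff (Equiv.ofBijective e hbij) fun S => ?_
  obtain ⟨A, hA, rfl⟩ := h.exists_list S
  rw [← h.has_iff A hA, h'.has_iff A hA]
  congr! 1
  ext q
  obtain ⟨p, rfl⟩ := hbij.2 q
  simp [hbij.1.eq_iff, he]

variable {K : Type v} [Field K]

theorem IsLabelling.realizes_iff {τ : ConfigType} {f : PlanarSpace P} {φ : P → ℕ}
    (h : IsLabelling τ f φ) {σ : ℕ → ProjSpace3 K} :
    Realizes τ σ ↔ ∀ S, f.Indep S ↔ Ind (σ ∘ φ) S := by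
  have key : ∀ A : List ℕ, A ⊆ τ.1 → (Ind (σ ∘ φ) (φ ⁻¹' {x | x ∈ A}) ↔ Ind σ {x | x ∈ A}) := by
    intro A hA
    rw [← ind_image h.injective, Set.image_preimage_eq_of_subset]
    exact fun x hx => (h.mem_iff x).1 (hA hx)
  constructor
  · intro hσ S
    obtain ⟨A, hA, rfl⟩ := h.exists_list S
    rw [key A hA, ← hσ A hA, h.has_iff A hA]
  · intro hσ A hA
    rw [h.has_iff A hA, hσ, key A hA]

variable (K) in
-- Restriction along the labelling and extension by the base point are inverse to each other.
theorem Matches.count_eq {τ : ConfigType} {f : PlanarSpace P} (h : Matches τ f) :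
    count K τ = f.numRealizations K := by
  obtain ⟨φ, h⟩ := h
  rw [count, ← Nat.card_coe_set_eq, PlanarSpace.numRealizations]
  refine Nat.card_congr ⟨fun σ => PlanarSpace.strongRealizationOfIndep (σ.1 ∘ φ)
    (h.realizes_iff.1 σ.2.2), fun ρ => ⟨Function.extend φ ρ.toFun fun _ => base K, ?_, ?_⟩,
    ?_, ?_⟩
  · intro x hx
    rw [Function.extend_apply']
    exact fun hx' => hx ((h.mem_iff x).2 hx')
  · rw [h.realizes_iff, Function.extend_comp h.injective]
    exact PlanarSpace.indep_iff_ind_of_strong ρ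
  · rintro ⟨σ, hσ, hσ'⟩
    apply Subtype.ext
    funext x
    change Function.extend φ (σ ∘ φ) (fun _ => base K) x = σ x
    by_cases hx : x ∈ Set.range φ
    · obtain ⟨p, rfl⟩ := hx
      rw [h.injective.extend_apply, Function.comp_apply]
    · rw [Function.extend_apply' _ _ _ fun h => hx h]
      exact (hσ x fun hx' => hx ((h.mem_iff x).1 hx')).symm
  · intro ρ
    apply PlanarSpace.StrongRealization.ext_toFun
    exact Function.extend_comp h.injective ρ.toFun fun _ => base K

end ConfigType

/-! ### Types computed from codes. -/

namespace PlanarCode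

variable {P : Type u}

theorem encard_setOf_label_mem {n : ℕ} (e : P ≃ Fin n) {S : List ℕ}
    (hS : S ∈ (List.range n).sublists') : {p | (e p : ℕ) ∈ S}.encard = S.length := by
  have hsub := List.mem_sublists'.1 hS
  have hnd : S.Nodup := List.nodup_range.sublist hsub
  have hinj : Function.Injective fun p => (e p : ℕ) := Fin.val_injective.comp e.injective
  rw [← hinj.encard_image]
  have : (fun p => (e p : ℕ)) '' {p | (e p : ℕ) ∈ S} = (S.toFinset : Set ℕ) := by
    ext x
    simp only [Set.mem_image, Set.mem_ofPred_eq, List.coe_toFinset]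
    constructor
    · rintro ⟨p, hp, rfl⟩
      exact hp
    · intro hx
      have hxn : x < n := List.mem_range.1 (hsub.subset hx)
      exact ⟨e.symm ⟨x, hxn⟩, by simpa using hx, by simp⟩
  rw [this, Set.encard_coe_eq_coe_finsetCard, List.toFinset_card_of_nodup hnd]

/-- Only `S` has to consist of labels of points: superfluous entries of `l` do no harm, and a
description may contain them. -/
theorem setOf_label_mem_subset_iff {n : ℕ} (e : P ≃ Fin n) {S l : List ℕ}
    (hS : S ∈ (List.range n).sublists') :
    {p | (e p : ℕ) ∈ S} ⊆ {p | (e p : ℕ) ∈ l} ↔ S ⊆ l := by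
  constructor
  · intro h x hx
    have hxn : x < n := List.mem_range.1 ((List.mem_sublists'.1 hS).subset hx)
    have := @h (e.symm ⟨x, hxn⟩) (by simpa using hx)
    simpa using this
  · exact fun h p hp => h hp

theorem indep_iff {c : PlanarCode} {f : PlanarSpace P} (e : P ≃ Fin c.1)
    (h1 : f.lines = {L | ∃ l ∈ c.2.1, L = {p | (e p : ℕ) ∈ l}})
    (h2 : f.planes = {H | ∃ l ∈ c.2.2, H = {p | (e p : ℕ) ∈ l}})
    {S : List ℕ} (hS : S ∈ (List.range c.1).sublists') :
    c.Indep S ↔ f.Indep {p | (e p : ℕ) ∈ S} := by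
  have hc := encard_setOf_label_mem e hS
  have hline : (∃ L ∈ f.lines, {p | (e p : ℕ) ∈ S} ⊆ L) ↔ ∃ l ∈ c.2.1, S ⊆ l := by
    simp [h1, setOf_label_mem_subset_iff e hS]
  have hplane : (∃ H ∈ f.planes, {p | (e p : ℕ) ∈ S} ⊆ H) ↔ ∃ l ∈ c.2.2, S ⊆ l := by
    simp [h2, setOf_label_mem_subset_iff e hS]
  have hcol (h : 2 ≤ S.length) : f.Collinear {p | (e p : ℕ) ∈ S} ↔ ∃ l ∈ c.2.1, S ⊆ l := by
    rw [PlanarSpace.Collinear, hline, or_iff_right]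
    rw [← Set.encard_le_one_iff_subsingleton, hc]
    exact_mod_cast (show ¬ S.length ≤ 1 by omega)
  have e2 : ((S.length : ℕ∞) ≤ 2) ↔ S.length ≤ 2 := by exact_mod_cast Iff.rfl
  have e3 : ((S.length : ℕ∞) = 3) ↔ S.length = 3 := by exact_mod_cast Iff.rfl
  have e4 : ((S.length : ℕ∞) = 4) ↔ S.length = 4 := by exact_mod_cast Iff.rfl
  rw [PlanarCode.Indep, PlanarSpace.Indep, hc, e2, e3, e4, PlanarSpace.Coplanar, hplane]
  refine or_congr_right (or_congr (and_congr_right fun h => ?_) (and_congr_right fun h => ?_))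
  · rw [hcol (by omega)]
  · rw [hcol (by omega), not_or]

theorem wf_type (c : PlanarCode) : c.type.Wf := by
  refine ⟨List.nodup_range, (List.nodup_sublists'.2 List.nodup_range).filter _, ?_, ?_⟩ <;>
  · intro T hT
    have := List.mem_sublists'.1 (List.mem_filter.1 hT).1
    first
      | exact List.pairwise_lt_range.sublist this
      | exact this.subset

theorem Describes.matches_type {c : PlanarCode} {f : PlanarSpace P} (h : c.Describes f) :
    c.type.Matches f := by
  obtain ⟨e, h1, h2⟩ := h
  refine ⟨fun p => e p, Fin.val_injective.comp e.injective, fun x => ?_, fun A hA => ?_⟩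
  · rw [PlanarCode.type, List.mem_range]
    constructor
    · intro hx
      exact ⟨e.symm ⟨x, hx⟩, by simp⟩
    · rintro ⟨p, rfl⟩
      exact (e p).2
  · constructor
    · rintro ⟨T, hT, hTA, hAT⟩
      obtain ⟨hT1, hT2⟩ := List.mem_filter.1 hT
      rw [decide_eq_true_eq, indep_iff e h1 h2 hT1] at hT2
      have : {p | (e p : ℕ) ∈ T} = (fun p => (e p : ℕ)) ⁻¹' {x | x ∈ A} := by
        ext p
        exact ⟨fun h => hTA h, fun h => hAT h⟩
      rwa [← this]
    · intro h
      have hT1 : (List.range c.1).filter (· ∈ A) ∈ (List.range c.1).sublists' := by simp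
      refine ⟨(List.range c.1).filter (· ∈ A), List.mem_filter.2 ⟨hT1, ?_⟩,
        fun x hx => by simpa using (List.mem_filter.1 hx).2,
        fun x hx => List.mem_filter.2 ⟨hA hx, by simpa using hx⟩⟩
      rw [decide_eq_true_eq, indep_iff e h1 h2 hT1]
      convert h using 1
      ext p
      simp

end PlanarCode

namespace ConfigType

theorem mem_tuples {V : List ℕ} {n : ℕ} {l : List ℕ} :
    l ∈ tuples V n ↔ l.length = n ∧ l ⊆ V := by
  induction n generalizing l with
  | zero => simp [tuples, List.length_eq_zero_iff]; rintro rfl; simp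
  | succ n ih =>
    have : tuples V (n + 1) = (tuples V n).flatMap fun l => V.map fun x => x :: l := rfl
    rw [this]
    simp only [List.mem_flatMap, List.mem_map, ih]
    constructor
    · rintro ⟨l, ⟨rfl, hl⟩, x, hx, rfl⟩
      simp [hx, hl]
    · rintro ⟨h1, h2⟩
      obtain ⟨x, l, rfl⟩ := List.exists_cons_of_length_eq_add_one h1
      rw [List.cons_subset] at h2
      exact ⟨l, ⟨by simpa using h1, h2.2⟩, x, h2.1, rfl⟩

theorem matchesCode_iff {P : Type u} {τ : ConfigType} (hτ : τ.1.Nodup) {d : PlanarCode}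
    {f : PlanarSpace P} (hd : d.Describes f) : MatchesCode τ d ↔ Matches τ f := by
  obtain ⟨e, h1, h2⟩ := hd
  constructor
  · rintro ⟨hlen, l, hl, hVl, hiff⟩
    obtain ⟨hl1, hl2⟩ := mem_tuples.1 hl
    -- A list that contains all labels and is no longer than their number is a permutation of them,
    -- so it defines a bijection.
    have hperm : τ.1.Perm l :=
      (hτ.subperm fun x hx => hVl x hx).perm_of_length_le (by rw [hl1, hlen])
    have hlnd : l.Nodup := hperm.nodup_iff.1 hτ
    have hlt : ∀ p, (e p : ℕ) < l.length := fun p => (e p).2.trans_eq hl1.symm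
    have hget : ∀ p, l.getD (e p) 0 = l[(e p : ℕ)]'(hlt p) := fun p =>
      List.getD_eq_getElem _ _ (hlt p)
    refine ⟨fun p => l.getD (e p) 0, fun p q hpq => ?_, fun x => ?_, fun A hA => ?_⟩
    · simp only [hget] at hpq
      exact e.injective (Fin.ext ((hlnd.getElem_inj_iff).1 hpq))
    · constructor
      · intro hx
        obtain ⟨i, hi, rfl⟩ := List.getElem_of_mem (hVl x hx)
        refine ⟨e.symm ⟨i, hi.trans_eq hl1⟩, ?_⟩
        simp [hi]
      · rintro ⟨p, rfl⟩
        simp only [hget]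
        exact hl2 (List.getElem_mem _)
    · have hS : (List.range d.1).filter (fun i => l.getD i 0 ∈ A) ∈
          (List.range d.1).sublists' := by simp
      have h3 := hiff _ hS
      rw [PlanarCode.indep_iff e h1 h2 hS] at h3
      have h4 : {p | (e p : ℕ) ∈ (List.range d.1).filter (fun i => l.getD i 0 ∈ A)} =
          (fun p => l.getD (e p) 0) ⁻¹' {x | x ∈ A} := by
        ext p
        simp
      rw [h4] at h3
      rw [← h3]
      refine has_congr fun x => ?_
      simp only [List.mem_map, List.mem_filter, List.mem_range, decide_eq_true_eq]
      constructor
      · intro hx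
        obtain ⟨i, hi, rfl⟩ := List.getElem_of_mem (hVl x (hA hx))
        refine ⟨i, ⟨hi.trans_eq hl1, ?_⟩, ?_⟩ <;> rw [List.getD_eq_getElem _ _ hi]
        exact hx
      · rintro ⟨i, ⟨-, hi⟩, rfl⟩
        exact hi
  · rintro ⟨φ, h⟩
    have hget : ∀ i (hi : i < d.1), (List.ofFn fun i => φ (e.symm i)).getD i 0 =
        φ (e.symm ⟨i, hi⟩) := fun i hi => by
      rw [List.getD_eq_getElem _ _ (by simpa using hi)]
      simp
    have hmem : ∀ x, x ∈ τ.1 ↔ x ∈ List.ofFn fun i => φ (e.symm i) := fun x => by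
      rw [h.mem_iff, List.mem_ofFn, Set.mem_range, e.symm.surjective.exists]
    have hnd : (List.ofFn fun i => φ (e.symm i)).Nodup :=
      List.nodup_ofFn.2 (h.injective.comp e.symm.injective)
    have hlen : τ.1.length = d.1 := by
      rw [((List.perm_ext_iff_of_nodup hτ hnd).2 hmem).length_eq, List.length_ofFn]
    refine ⟨hlen, List.ofFn fun i => φ (e.symm i),
      mem_tuples.2 ⟨List.length_ofFn, fun x hx => (hmem x).2 hx⟩, fun x hx => (hmem x).1 hx,
      fun S hS => ?_⟩
    have hSn : ∀ i ∈ S, i < d.1 := fun i hi =>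
      List.mem_range.1 ((List.mem_sublists'.1 hS).subset hi)
    rw [PlanarCode.indep_iff e h1 h2 hS, h.has_iff]
    · congr! 1
      ext p
      simp only [Set.mem_preimage, Set.mem_ofPred_eq, List.mem_map]
      constructor
      · rintro ⟨i, hi, hip⟩
        rw [hget i (hSn i hi)] at hip
        rw [← h.injective hip]
        simpa using hi
      · intro hp
        exact ⟨e p, hp, by rw [hget _ (e p).2]; simp⟩
    · intro x hx
      obtain ⟨i, hi, rfl⟩ := List.mem_map.1 hx
      rw [hget i (hSn i hi), h.mem_iff]
      exact ⟨_, rfl⟩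

end ConfigType

/-! ### Points of small index have at most two minimal constraints. -/

section TraceSpace

variable {K : Type v} [Field K] {P : Type u}

/-- The points with labels in a subspace. -/
def traceOf (ρ : P → ProjSpace3 K) (W : Submodule K (Fin 4 → K)) : Set P := {x | (ρ x).rep ∈ W}

theorem subset_traceOf_iff {ρ : P → ProjSpace3 K} {W : Submodule K (Fin 4 → K)} {S : Set P} :
    S ⊆ traceOf ρ W ↔ spanOf ρ S ≤ W := spanOf_le_iff.symm

theorem Ind.spanOf_eq {ρ : P → ProjSpace3 K} {S : Set P} (h : Ind ρ S)
    {W : Submodule K (Fin 4 → K)} (hW : S.encard = Module.finrank K W) (hS : S ⊆ traceOf ρ W) :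
    spanOf ρ S = W :=
  Submodule.eq_of_le_of_finrank_eq (subset_traceOf_iff.1 hS) (by
    rw [h.encard] at hW
    exact_mod_cast hW)

/-- The planar space of a set of points of projective space. -/
def traceSpace (ρ : P → ProjSpace3 K) (hρ : Function.Injective ρ) : PlanarSpace P where
  lines := {L | (∃ W : Submodule K (Fin 4 → K), Module.finrank K W = 2 ∧ L = traceOf ρ W) ∧
    -- The axioms demand two points on a line, and a 2-dimensional subspace may meet the set in
    -- fewer.
    L.Nontrivial}
  -- Traces all of whose points are collinear are harmless here: they contain no non-collinear
  -- triple and are not full planes.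
  planes := {H | ∃ W : Submodule K (Fin 4 → K), Module.finrank K W = 3 ∧ H = traceOf ρ W}
  existsUnique_line a b hab := by
    have hi : Ind ρ {a, b} := (ind_pair_iff hab).2 fun h => hab (hρ h)
    have hW : Module.finrank K (spanOf ρ {a, b}) = 2 := by
      rw [hi.finrank_spanOf, Set.ncard_pair hab]
    have ha : a ∈ traceOf ρ (spanOf ρ {a, b}) := rep_mem_spanOf ρ (by simp)
    have hb : b ∈ traceOf ρ (spanOf ρ {a, b}) := rep_mem_spanOf ρ (by simp)
    refine ⟨_, ⟨⟨⟨_, hW, rfl⟩, a, ha, b, hb, hab⟩, ha, hb⟩, ?_⟩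
    rintro _ ⟨⟨⟨W, hW', rfl⟩, -⟩, ha', hb'⟩
    rw [hi.spanOf_eq (by rw [Set.encard_pair hab, hW']; rfl) (Set.pair_subset ha' hb')]
  nontrivial_of_line := by
    rintro L ⟨-, a, ha, b, hb, hab⟩
    exact ⟨a, ha, b, hb, hab⟩
  existsUnique_plane a b c hab hac hbc hL := by
    have h3 : ({a, b, c} : Set P).encard = (2 + 1 : ℕ) :=
      Set.encard_eq_three.2 ⟨a, b, c, hab, hac, hbc, rfl⟩
    have hi : Ind ρ {a, b, c} := by
      rw [ind_iff_of_encard_eq h3]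
      intro h
      obtain ⟨W, hW, hW'⟩ := exists_le_finrank_eq h (by norm_num)
      rw [← subset_traceOf_iff] at hW
      have ha := hW (show a ∈ ({a, b, c} : Set P) by simp)
      have hb := hW (show b ∈ ({a, b, c} : Set P) by simp)
      exact hL ⟨_, ⟨⟨W, hW', rfl⟩, a, ha, b, hb, hab⟩, ha, hb,
        hW (show c ∈ ({a, b, c} : Set P) by simp)⟩
    have hW : Module.finrank K (spanOf ρ {a, b, c}) = 3 := by
      have := hi.encard
      rw [h3] at this
      exact_mod_cast this.symm
    have hmem : ∀ x ∈ ({a, b, c} : Set P), x ∈ traceOf ρ (spanOf ρ {a, b, c}) :=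
      fun x hx => rep_mem_spanOf ρ hx
    refine ⟨_, ⟨⟨_, hW, rfl⟩, hmem a (by simp), hmem b (by simp), hmem c (by simp)⟩, ?_⟩
    rintro _ ⟨⟨W, hW', rfl⟩, ha', hb', hc'⟩
    rw [hi.spanOf_eq (by rw [h3, hW']) (by simp [Set.insert_subset_iff, ha', hb', hc'])]

/-- The points of the planar space of a set of points form a strong realization. -/
def traceSpaceRealization (ρ : P → ProjSpace3 K) (hρ : Function.Injective ρ) :
    (traceSpace ρ hρ).StrongRealization K where
  toFun := ρ
  injective := hρ
  line_iff S := by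
    rw [inProjLine_image_iff]
    constructor
    · intro h
      by_cases hS : S.Subsingleton
      · exact .inl hS
      · obtain ⟨W, hW, hW'⟩ := exists_le_finrank_eq h (by norm_num)
        rw [← subset_traceOf_iff] at hW
        exact .inr ⟨_, ⟨⟨W, hW', rfl⟩, (Set.not_subsingleton_iff.1 hS).mono hW⟩, hW⟩
    · rintro (h | ⟨_, ⟨⟨W, hW, rfl⟩, -⟩, h⟩)
      · have h1 : S.encard ≤ 1 := Set.encard_le_one_iff_subsingleton.2 h
        have h2 := (ind_of_encard_le_two hρ (h1.trans (by decide))).encard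
        rw [h2] at h1
        have : Module.finrank K (spanOf ρ S) ≤ 1 := by exact_mod_cast h1
        omega
      · exact hW ▸ Submodule.finrank_mono (subset_traceOf_iff.1 h)
  plane_iff S := by
    rw [inProjPlane_image_iff]
    constructor
    · intro h
      obtain ⟨W, hW, hW'⟩ := exists_le_finrank_eq h (by norm_num)
      exact .inr ⟨_, ⟨W, hW', rfl⟩, subset_traceOf_iff.2 hW⟩
    · rintro (h | ⟨_, ⟨W, hW, rfl⟩, h⟩)
      · have h1 : S.encard ≤ 2 ∨ ∃ W : Submodule K (Fin 4 → K), Module.finrank K W = 2 ∧ S ⊆ traceOf ρ W := by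
          rcases h with h | ⟨_, ⟨⟨W, hW, rfl⟩, -⟩, h⟩
          · exact .inl ((Set.encard_le_one_iff_subsingleton.2 h).trans (by decide))
          · exact .inr ⟨W, hW, h⟩
        have h2 : Module.finrank K (spanOf ρ S) ≤ 2 := by
          rcases h1 with h1 | ⟨W, hW, h⟩
          · rw [(ind_of_encard_le_two hρ h1).encard] at h1
            exact_mod_cast h1
          · exact hW ▸ Submodule.finrank_mono (subset_traceOf_iff.1 h)
        omega
      · exact hW ▸ Submodule.finrank_mono (subset_traceOf_iff.1 h)

theorem traceSpace_indep_iff {ρ : P → ProjSpace3 K} (hρ : Function.Injective ρ) (S : Set P) :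
    (traceSpace ρ hρ).Indep S ↔ Ind ρ S :=
  PlanarSpace.indep_iff_ind_of_strong (traceSpaceRealization ρ hρ) S

/-- The independent sets of the other points which span the point `p`. -/
def spanning (ρ : P → ProjSpace3 K) (p : P) : Set (Set P) :=
  {S | p ∉ S ∧ Ind ρ S ∧ (ρ p).rep ∈ spanOf ρ S}

/-- The subspaces of dimension `k` which are spanned by independent sets of points other than `p`,
and contain `p`. -/
def constraints (ρ : P → ProjSpace3 K) (p : P) (k : ℕ) : Set (Submodule K (Fin 4 → K)) :=
  {W | ∃ S ∈ spanning ρ p, S.encard = k ∧ spanOf ρ S = W}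

section Constraints

variable {ρ : P → ProjSpace3 K} {p : P} {k : ℕ} {L W W' : Submodule K (Fin 4 → K)}

theorem finrank_of_mem_constraints (h : W ∈ constraints ρ p k) : Module.finrank K W = k := by
  obtain ⟨S, ⟨-, h1, -⟩, h2, rfl⟩ := h
  rw [h1.encard] at h2
  exact_mod_cast h2

theorem rep_mem_of_mem_constraints (h : W ∈ constraints ρ p k) : (ρ p).rep ∈ W := by
  obtain ⟨S, ⟨-, -, h1⟩, -, rfl⟩ := h
  exact h1

theorem eq_of_mem_constraints (h : W ∈ constraints ρ p k) (h' : W' ∈ constraints ρ p k)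
    (hle : W ≤ W') : W = W' :=
  Submodule.eq_of_le_of_finrank_eq hle
    (by rw [finrank_of_mem_constraints h, finrank_of_mem_constraints h'])

/-- A constraint is spanned by points of its trace, so it can be recovered from the trace. -/
theorem traceOf_injOn_constraints (ρ : P → ProjSpace3 K) (p : P) (k : ℕ) :
    Set.InjOn (traceOf ρ) (constraints ρ p k) := by
  have key : ∀ W ∈ constraints ρ p k, ∀ W', traceOf ρ W = traceOf ρ W' → W ≤ W' := by
    rintro W ⟨S, -, -, rfl⟩ W' h
    rw [← subset_traceOf_iff, ← h, subset_traceOf_iff]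
  exact fun W hW W' hW' h => le_antisymm (key W hW W' h) (key W' hW' W h.symm)

/-- The trace of a constraint plane contains `p` and a non-collinear triple avoiding `p`, so it is
full. The inequality can be strict: a full plane whose points other than `p` are collinear does not
constrain `p`. -/
theorem ncard_constraints_three_le [Finite P] (hρ : Function.Injective ρ) :
    (constraints ρ p 3).ncard ≤ (traceSpace ρ hρ).planeIndex p := by
  refine Set.ncard_le_ncard_of_injOn (traceOf ρ) ?_ (traceOf_injOn_constraints ρ p 3)
    (Set.toFinite _)
  intro W hW
  have hW3 := finrank_of_mem_constraints hW
  obtain ⟨S, ⟨hpS, hS, hp⟩, hS3, rfl⟩ := hW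
  have hsub : S ⊆ traceOf ρ (spanOf ρ S) := subset_traceOf_iff.2 le_rfl
  refine ⟨⟨⟨_, hW3, rfl⟩, ?_, fun h => ?_⟩, hp⟩
  · refine le_trans ?_ (Set.encard_le_encard (Set.insert_subset hp hsub))
    rw [Set.encard_insert_of_notMem hpS, hS3]
    decide
  · exact ((PlanarSpace.indep_iff_of_encard_eq_three hS3).1
      ((traceSpace_indep_iff hρ S).2 hS)) (h.mono hsub)

theorem ncard_constraints_two_le [Finite P] (hρ : Function.Injective ρ) :
    (constraints ρ p 2).ncard ≤ (traceSpace ρ hρ).lineIndex p := by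
  refine Set.ncard_le_ncard_of_injOn (traceOf ρ) ?_ (traceOf_injOn_constraints ρ p 2)
    (Set.toFinite _)
  intro W hW
  have hW2 := finrank_of_mem_constraints hW
  obtain ⟨S, ⟨hpS, hS, hp⟩, hS2, rfl⟩ := hW
  have hsub : S ⊆ traceOf ρ (spanOf ρ S) := subset_traceOf_iff.2 le_rfl
  have h2 : S.Nontrivial := Set.one_lt_encard_iff_nontrivial.1 (by rw [hS2]; decide)
  refine ⟨⟨⟨⟨_, hW2, rfl⟩, h2.mono hsub⟩, ?_⟩, hp⟩
  refine le_trans ?_ (Set.encard_le_encard (Set.insert_subset hp hsub))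
  rw [Set.encard_insert_of_notMem hpS, hS2]
  decide

/-- A full line through `p` has two further points, and these span it. Hence no constraint lines
means line index zero, which brings the case `(3, 0)` into play. -/
theorem constraints_two_nonempty (hρ : Function.Injective ρ)
    (h : (traceSpace ρ hρ).lineIndex p ≠ 0) : (constraints ρ p 2).Nonempty := by
  obtain ⟨_, ⟨⟨⟨⟨W, hW, rfl⟩, -⟩, h3⟩, hp⟩⟩ := Set.nonempty_of_ncard_ne_zero h
  have h2 : 1 < (traceOf ρ W \ {p}).encard := by
    by_contra! hle
    have := Set.encard_sdiff_singleton_add_one hp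
    rw [← this] at h3
    have h4 : (3 : ℕ∞) ≤ 1 + 1 := h3.trans (by gcongr)
    exact absurd h4 (by decide)
  obtain ⟨a, b, ha, hb, hab⟩ := Set.one_lt_encard_iff.1 h2
  have hi : Ind ρ {a, b} := (ind_pair_iff hab).2 fun h => hab (hρ h)
  have hspan := hi.spanOf_eq (by rw [Set.encard_pair hab, hW]; rfl) (Set.pair_subset ha.1 hb.1)
  refine ⟨W, {a, b}, ⟨?_, hi, hspan ▸ hp⟩, Set.encard_pair hab, hspan⟩
  rintro (rfl | rfl)
  · exact ha.2 rfl
  · exact hb.2 rfl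

/-- The plane spanned by a line through `p` and a point not on it. -/
theorem exists_mem_constraints_three (hL : L ∈ constraints ρ p 2) {s : P} (hs : (ρ s).rep ∉ L) :
    ∃ W ∈ constraints ρ p 3, L ≤ W ∧ (ρ s).rep ∈ W ∧ ∀ U, L ≤ U → (ρ s).rep ∈ U → W ≤ U := by
  obtain ⟨S, ⟨hpS, hS, hp⟩, hS2, rfl⟩ := hL
  have hsS : s ∉ S := fun h => hs (rep_mem_spanOf ρ h)
  refine ⟨spanOf ρ (insert s S), ⟨insert s S, ⟨?_, (ind_insert hsS).2 ⟨hS, hs⟩,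
    spanOf_mono ρ (Set.subset_insert _ _) hp⟩, ?_, rfl⟩, spanOf_mono ρ (Set.subset_insert _ _),
    rep_mem_spanOf ρ (Set.mem_insert _ _), fun U hU hsU => ?_⟩
  · rintro (rfl | h)
    · exact hs hp
    · exact hpS h
  · rw [Set.encard_insert_of_notMem hsS, hS2]
    rfl
  · rw [spanOf_le_iff]
    rintro x (rfl | hx)
    · exact hsU
    · exact hU (rep_mem_spanOf ρ hx)

theorem le_of_mem_constraints_two (hρ : Function.Injective ρ) (hL : L ∈ constraints ρ p 2) {s : P}
    (hsp : s ≠ p) (hs : (ρ s).rep ∈ L) (hpW : (ρ p).rep ∈ W) (hsW : (ρ s).rep ∈ W) : L ≤ W := by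
  have hi : Ind ρ {s, p} := (ind_pair_iff hsp).2 fun h => hsp (hρ h)
  have hspan := hi.spanOf_eq (W := L)
    (by rw [Set.encard_pair hsp, finrank_of_mem_constraints hL]; rfl)
    (Set.pair_subset hs (rep_mem_of_mem_constraints hL))
  rw [← hspan, ← subset_traceOf_iff]
  exact Set.pair_subset hsW hpW

/-- By injectivity, no set of fewer than two other points spans `p`; four independent points span
everything. -/
theorem two_le_encard_of_mem_spanning (hρ : Function.Injective ρ) {S : Set P}
    (hS : S ∈ spanning ρ p) : S.encard = 2 ∨ S.encard = 3 ∨ spanOf ρ S = ⊤ := by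
  obtain ⟨hpS, hi, hp⟩ := hS
  have h1 := hi.encard
  have h2 : Module.finrank K (spanOf ρ S) ≤ 4 := by
    have := hi.encard_le
    rw [h1] at this
    exact_mod_cast this
  have h3 : ¬ S.Subsingleton := by
    intro h
    obtain rfl | ⟨a, rfl⟩ := h.eq_empty_or_singleton
    · simp [spanOf, Projectivization.rep_nonzero] at hp
    · have hpa : p ≠ a := fun h => hpS h
      have : Ind ρ {p, a} := (ind_pair_iff hpa).2 fun h => hpa (hρ h)
      exact ((ind_insert hpS).1 this).2 hp
  rw [← Set.encard_le_one_iff_subsingleton, h1] at h3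
  have h4 : ¬ Module.finrank K (spanOf ρ S) ≤ 1 := fun h => h3 (by exact_mod_cast h)
  have h5 : Module.finrank K (spanOf ρ S) = 2 ∨ Module.finrank K (spanOf ρ S) = 3 ∨
      Module.finrank K (spanOf ρ S) = 4 := by omega
  rcases h5 with h5 | h5 | h5
  · exact .inl (by rw [h1, h5]; rfl)
  · exact .inr (.inl (by rw [h1, h5]; rfl))
  · exact .inr (.inr (Submodule.eq_top_of_finrank_eq (by simp [h5])))

theorem finite_constraints [Finite P] (ρ : P → ProjSpace3 K) (p : P) (k : ℕ) :
    (constraints ρ p k).Finite :=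
  ((Set.toFinite (Set.univ : Set (Set P))).image (spanOf ρ)).subset
    fun _ ⟨S, _, _, h⟩ => ⟨S, trivial, h⟩

theorem four_le_ncard {T : Type u} {X : Set T} (hX : X.Finite) {a b c d : T} (ha : a ∈ X)
    (hb : b ∈ X) (hc : c ∈ X) (hd : d ∈ X) (hab : a ≠ b) (hac : a ≠ c) (had : a ≠ d)
    (hbc : b ≠ c) (hbd : b ≠ d) (hcd : c ≠ d) : 4 ≤ X.ncard := by
  have : ({a, b, c, d} : Set T).ncard = 4 := by
    rw [Set.ncard_insert_of_notMem (by simp [hab, hac, had]),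
      Set.ncard_eq_three.2 ⟨b, c, d, hbc, hbd, hcd, rfl⟩]
  rw [← this]
  exact Set.ncard_le_ncard (by simp [Set.insert_subset_iff, ha, hb, hc, hd]) hX

/-- Two planes through `p` which do not contain a line through `p`: there are at least four planes
through `p`. -/
theorem four_le_of_line [Finite P] (hρ : Function.Injective ρ) (hL : L ∈ constraints ρ p 2)
    {H H' : Submodule K (Fin 4 → K)} (hH : H ∈ constraints ρ p 3) (hH' : H' ∈ constraints ρ p 3)
    (hLH : ¬ L ≤ H) (hLH' : ¬ L ≤ H') (hne : H ≠ H') : 4 ≤ (constraints ρ p 3).ncard := by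
  obtain ⟨S, ⟨hpS, hS, hp⟩, hS3, rfl⟩ := id hH
  have hnot : ∀ s ∈ S, (ρ s).rep ∉ L := fun s hs h => hLH
    (le_of_mem_constraints_two hρ hL (fun e => hpS (e ▸ hs)) h hp (rep_mem_spanOf ρ hs))
  obtain ⟨s, hs⟩ : S.Nonempty := Set.nonempty_of_encard_ne_zero (by rw [hS3]; decide)
  -- Two planes through `L` complete the four: `W` joins `L` to a basis point `s` of `H`, and `U`
  -- joins `L` to a basis point of `H` outside `W`.
  obtain ⟨W, hW, hLW, hsW, -⟩ := exists_mem_constraints_three hL (hnot s hs)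
  obtain ⟨t, ht, htW⟩ : ∃ t ∈ S, (ρ t).rep ∉ W := by
    by_contra! h
    exact hLH (eq_of_mem_constraints hH hW (spanOf_le_iff.2 h) ▸ hLW)
  obtain ⟨U, hU, hLU, htU, -⟩ := exists_mem_constraints_three hL (hnot t ht)
  exact four_le_ncard (finite_constraints ρ p 3) hW hU hH hH' (fun e => htW (e ▸ htU))
    (fun e => hLH (e ▸ hLW)) (fun e => hLH' (e ▸ hLW)) (fun e => hLH (e ▸ hLU))
    (fun e => hLH' (e ▸ hLU)) hne

/-- A plane through `p` which contains neither of two lines through `p`: there are at least four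
planes through `p`. -/
theorem four_le_of_lines [Finite P] (hρ : Function.Injective ρ) (hL : L ∈ constraints ρ p 2)
    {L' H : Submodule K (Fin 4 → K)} (hL' : L' ∈ constraints ρ p 2) (hne : L ≠ L')
    (hH : H ∈ constraints ρ p 3) (hLH : ¬ L ≤ H) (hLH' : ¬ L' ≤ H) :
    4 ≤ (constraints ρ p 3).ncard := by
  obtain ⟨S, ⟨hpS, hS, hp⟩, hS3, rfl⟩ := id hH
  obtain ⟨T, ⟨hpT, hT, hpT'⟩, hT2, rfl⟩ := id hL'
  obtain ⟨c, hc⟩ : T.Nonempty := Set.nonempty_of_encard_ne_zero (by rw [hT2]; decide)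
  have hcp : c ≠ p := fun e => hpT (e ▸ hc)
  have hcL : (ρ c).rep ∉ L := fun h => hne (eq_of_mem_constraints hL hL'
    (le_of_mem_constraints_two hρ hL hcp h hpT' (rep_mem_spanOf ρ hc)))
  -- `W` is the plane of both lines; `U` and `U'` join each line to a basis point `s` of `H` off
  -- `W`. If `U = U'`, this plane contains both lines and so is `W`, which does not contain `s`.
  obtain ⟨W, hW, hLW, hcW, hWmin⟩ := exists_mem_constraints_three hL hcL
  have hL'W := le_of_mem_constraints_two hρ hL' hcp (rep_mem_spanOf ρ hc)
    (rep_mem_of_mem_constraints hW) hcW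
  obtain ⟨s, hs, hsW⟩ : ∃ s ∈ S, (ρ s).rep ∉ W := by
    by_contra! h
    exact hLH (eq_of_mem_constraints hH hW (spanOf_le_iff.2 h) ▸ hLW)
  obtain ⟨U, hU, hLU, hsU, -⟩ := exists_mem_constraints_three hL fun h => hsW (hLW h)
  obtain ⟨U', hU', hLU', hsU', -⟩ := exists_mem_constraints_three hL' fun h => hsW (hL'W h)
  refine four_le_ncard (finite_constraints ρ p 3) hW hU hU' hH (fun e => hsW (e ▸ hsU))
    (fun e => hsW (e ▸ hsU')) (fun e => hLH (e ▸ hLW)) (fun e => ?_) (fun e => hLH (e ▸ hLU))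
    (fun e => hLH' (e ▸ hLU'))
  subst e
  exact hsW (eq_of_mem_constraints hW hU
    (hWmin U hLU (hLU' (rep_mem_spanOf ρ hc))) ▸ hsU)

/-- If the index of `p` is small, the constraints on the position of `p` have at most two minimal
members. -/
theorem exists_minimal_constraints [Finite P] (hρ : Function.Injective ρ)
    (hi : ¬ (4 ≤ (traceSpace ρ hρ).planeIndex p ∨ 3 ≤ (traceSpace ρ hρ).lineIndex p ∨
      ((traceSpace ρ hρ).planeIndex p = 3 ∧ (traceSpace ρ hρ).lineIndex p = 0))) :
    spanning ρ p = ∅ ∨ ∃ F ∈ spanning ρ p, ∃ G ∈ spanning ρ p, ∀ S ∈ spanning ρ p,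
      spanOf ρ F ≤ spanOf ρ S ∨ spanOf ρ G ≤ spanOf ρ S := by
  have h3 := ncard_constraints_three_le (p := p) hρ
  have h2 := ncard_constraints_two_le (p := p) hρ
  have hj := constraints_two_nonempty (p := p) hρ
  set i := (traceSpace ρ hρ).planeIndex p
  set j := (traceSpace ρ hρ).lineIndex p
  have hlt : (constraints ρ p 3).ncard < 4 := by omega
  have hcases : ∀ S ∈ spanning ρ p, spanOf ρ S ∈ constraints ρ p 2 ∨
      spanOf ρ S ∈ constraints ρ p 3 ∨ spanOf ρ S = ⊤ := by
    intro S hS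
    rcases two_le_encard_of_mem_spanning hρ hS with h | h | h
    · exact .inl ⟨S, hS, h, rfl⟩
    · exact .inr (.inl ⟨S, hS, h, rfl⟩)
    · exact .inr (.inr h)
  have h2' : (constraints ρ p 2).ncard = 0 ∨ (constraints ρ p 2).ncard = 1 ∨
      (constraints ρ p 2).ncard = 2 := by omega
  rcases h2' with h2' | h2' | h2'
  -- No constraint line: the line index is 0, so excluding `(3, 0)` leaves at most two constraint
  -- planes, and these are minimal.
  · rw [Set.ncard_eq_zero (finite_constraints ρ p 2)] at h2'
    have hj0 : j = 0 := by
      by_contra h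
      simp [h2'] at hj
      omega
    have h3' : (constraints ρ p 3).ncard = 0 ∨ (constraints ρ p 3).ncard = 1 ∨
      (constraints ρ p 3).ncard = 2 := by omega
    simp only [h2', Set.mem_empty_iff_false, false_or] at hcases
    rcases h3' with h3' | h3' | h3'
    · rw [Set.ncard_eq_zero (finite_constraints ρ p 3)] at h3'
      simp only [h3', Set.mem_empty_iff_false, false_or] at hcases
      rcases (spanning ρ p).eq_empty_or_nonempty with h | ⟨F, hF⟩
      · exact .inl h
      · exact .inr ⟨F, hF, F, hF, fun S hS => .inl (by rw [hcases S hS]; exact le_top)⟩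
    · obtain ⟨W, hW⟩ := Set.ncard_eq_one.1 h3'
      obtain ⟨F, hF, -, hFW⟩ : W ∈ constraints ρ p 3 := by simp [hW]
      refine .inr ⟨F, hF, F, hF, fun S hS => .inl ?_⟩
      rcases hcases S hS with h | h
      · rw [hW] at h
        rw [hFW, h]
      · simp [h]
    · obtain ⟨W, W', -, hW⟩ := Set.ncard_eq_two.1 h3'
      obtain ⟨F, hF, -, hFW⟩ : W ∈ constraints ρ p 3 := by simp [hW]
      obtain ⟨G, hG, -, hGW⟩ : W' ∈ constraints ρ p 3 := by simp [hW]
      refine .inr ⟨F, hF, G, hG, fun S hS => ?_⟩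
      rcases hcases S hS with h | h
      · rw [hW] at h
        rcases h with h | h
        · exact .inl (by rw [hFW, h])
        · exact .inr (by rw [hGW, h])
      · simp [h]
  · obtain ⟨L, hL⟩ := Set.ncard_eq_one.1 h2'
    have hLm : L ∈ constraints ρ p 2 := by simp [hL]
    obtain ⟨F, hF, -, hFL⟩ := id hLm
    simp only [hL, Set.mem_singleton_iff] at hcases
    -- One line `L`: by `four_le_of_line` at most one constraint plane fails to contain `L`, and it
    -- is the other minimal constraint.
    by_cases hex : ∃ H ∈ constraints ρ p 3, ¬ L ≤ H
    · obtain ⟨H, hH, hLH⟩ := hex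
      obtain ⟨G, hG, -, hGH⟩ := id hH
      refine .inr ⟨F, hF, G, hG, fun S hS => ?_⟩
      rw [hFL, hGH]
      rcases hcases S hS with h | h | h
      · simp [h]
      · by_contra! hno
        exact absurd (four_le_of_line hρ hLm hH h hLH hno.1 fun e => hno.2 e.le) (by omega)
      · simp [h]
    · push Not at hex
      refine .inr ⟨F, hF, F, hF, fun S hS => .inl ?_⟩
      rw [hFL]
      rcases hcases S hS with h | h | h
      · exact h.ge
      · exact hex _ h
      · simp [h]
  · obtain ⟨L, L', hne, hL⟩ := Set.ncard_eq_two.1 h2'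
    have hLm : L ∈ constraints ρ p 2 := by simp [hL]
    have hLm' : L' ∈ constraints ρ p 2 := by simp [hL]
    obtain ⟨F, hF, -, hFL⟩ := id hLm
    obtain ⟨G, hG, -, hGL⟩ := id hLm'
    -- Two lines: by `four_le_of_lines` every constraint plane contains one of them.
    refine .inr ⟨F, hF, G, hG, fun S hS => ?_⟩
    rw [hFL, hGL]
    rcases hcases S hS with h | h | h
    · rw [hL] at h
      rcases h with h | h
      · exact .inl h.ge
      · exact .inr h.ge
    · by_contra! hno
      exact absurd (four_le_of_lines hρ hLm hLm' hne h hno.1 hno.2) (by omega)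
    · simp [h]

end Constraints

end TraceSpace

/-! ### Terminal types are hyperfigurations. -/

namespace ConfigType

variable {K : Type v} [Field K]

theorem Realizes.cl_iff {τ : ConfigType} (hτ : Wf τ) {σ : ℕ → ProjSpace3 K} (hσ : Realizes τ σ)
    {S : List ℕ} (hS : S ∈ τ.2) {y : ℕ} (hy : y ∈ τ.1) :
    Cl τ.2 S y ↔ (σ y).rep ∈ spanOf σ {x | x ∈ S} := by
  by_cases hyS : y ∈ S
  · exact ⟨fun _ => rep_mem_spanOf σ hyS, fun _ => .inl hyS⟩
  · have h1 := (hσ S (hτ.subset S hS)).1 (has_of_mem hS)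
    have h2 := hσ (y :: S) (List.cons_subset.2 ⟨hy, hτ.subset S hS⟩)
    rw [ind_cons hyS] at h2
    simp only [Cl, hyS, false_or, h2, h1, true_and, not_not]

theorem Realizes.exists_mem {τ : ConfigType} {σ : ℕ → ProjSpace3 K} (hσ : Realizes τ σ)
    {S : Set ℕ} (hS : ∀ x ∈ S, x ∈ τ.1) (hi : Ind σ S) : ∃ T ∈ τ.2, {x | x ∈ T} = S := by
  classical
  have hA : {x | x ∈ τ.1.filter (· ∈ S)} = S := by
    ext x
    simpa using hS x
  obtain ⟨T, hT, h1, h2⟩ := (hσ (τ.1.filter (· ∈ S)) (List.filter_subset_self _)).2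
    (by rw [hA]; exact hi)
  refine ⟨T, hT, ?_⟩
  rw [← hA]
  ext x
  exact ⟨fun h => h1 h, fun h => h2 h⟩

/-- If the constraints on the position of a point have at most two minimal members, then the
expansion at this point is possible. -/
theorem choices_ne_nil {τ : ConfigType} (hτ : Wf τ) {σ : ℕ → ProjSpace3 K} (hσ : Realizes τ σ)
    {p : ℕ} (hp : p ∈ τ.1) {C : Set (Set ℕ)} (hC : C = spanning σ p ∩ {S | ∀ x ∈ S, x ∈ τ.1})
    (h : C = ∅ ∨ ∃ F ∈ C, ∃ G ∈ C, ∀ S ∈ C,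
      spanOf σ F ≤ spanOf σ S ∨ spanOf σ G ≤ spanOf σ S) : choices τ ≠ [] := by
  have hmem : ∀ S ∈ del τ.2 p, Cl τ.2 S p → {x | x ∈ S} ∈ C := by
    intro S hS hcl
    obtain ⟨hS1, hS2⟩ := mem_del.1 hS
    rw [hσ.cl_iff hτ hS1 hp] at hcl
    have hi := (hσ S (hτ.subset S hS1)).1 (has_of_mem hS1)
    rw [hC]
    exact ⟨⟨hS2, hi, hcl⟩, hτ.subset S hS1⟩
  rcases h with h | ⟨F', hF', G', hG', hmin⟩
  · refine List.ne_nil_of_mem (mem_choices.2 ⟨hp, .inl ⟨fun S hS hcl => ?_, rfl⟩⟩)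
    exact Set.notMem_empty _ (h ▸ hmem S hS hcl)
  · have hF2 := hC ▸ hF'
    have hG2 := hC ▸ hG'
    obtain ⟨F, hF, rfl⟩ := hσ.exists_mem hF2.2 hF2.1.2.1
    obtain ⟨G, hG, rfl⟩ := hσ.exists_mem hG2.2 hG2.1.2.1
    obtain ⟨I', hI1, hI2, hI3⟩ := exists_ind_subset σ ({x | x ∈ F} ∪ {x | x ∈ G})
    obtain ⟨I, hI, rfl⟩ := hσ.exists_mem (fun x hx => (hI1 hx).elim (hF2.2 x) (hG2.2 x)) hI2
    have hFG : ∀ y ∈ F ++ G, y ∈ τ.1 := fun y hy =>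
      (List.mem_append.1 hy).elim (hF2.2 y) (hG2.2 y)
    have hcl : ∀ S ∈ τ.2, ∀ T : List ℕ, (∀ y ∈ T, y ∈ τ.1) →
        spanOf σ {x | x ∈ T} ≤ spanOf σ {x | x ∈ S} → ∀ y ∈ T, Cl τ.2 S y :=
      fun S hS T hT hle y hy => (hσ.cl_iff hτ hS (hT y hy)).2 (hle (rep_mem_spanOf σ hy))
    refine List.ne_nil_of_mem (mem_choices.2 ⟨hp, .inr ⟨(F, G, I), ⟨mem_del.2 ⟨hF, hF2.1.1⟩,
      mem_del.2 ⟨hG, hG2.1.1⟩, mem_del.2 ⟨hI, fun h => (hI1 h).elim hF2.1.1 hG2.1.1⟩⟩,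
      ⟨⟨(hσ.cl_iff hτ hF hp).2 hF2.1.2.2, (hσ.cl_iff hτ hG hp).2 hG2.1.2.2⟩,
        ⟨fun x hx => List.mem_append.2 (hI1 hx), hcl I hI (F ++ G) hFG ?_⟩, fun S hS => ?_⟩,
      rfl⟩⟩)
    · rw [hI3]
      exact spanOf_mono σ fun x hx => List.mem_append.1 hx
    · by_cases hSp : Cl τ.2 S p
      · exact .inr ((hmin _ (hmem S hS hSp)).imp (hcl S (mem_del.1 hS).1 F hF2.2)
          (hcl S (mem_del.1 hS).1 G hG2.2))
      · exact .inl hSp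

/-- If `x` coincides with another point `y`, the constraint `{y}` lies below all constraints on `x`,
so an expansion at `x` would be possible. -/
theorem injOn_of_choices_eq_nil {τ : ConfigType} (hτ : Wf τ) {σ : ℕ → ProjSpace3 K}
    (hσ : Realizes τ σ) (h : choices τ = []) {x y : ℕ} (hx : x ∈ τ.1) (hy : y ∈ τ.1)
    (hxy : σ x = σ y) : x = y := by
  by_contra hne
  have hyC : {y} ∈ spanning σ x ∩ {S | ∀ x ∈ S, x ∈ τ.1} :=
    ⟨⟨hne, LinearIndepOn.singleton (σ y).rep_nonzero, hxy ▸ rep_mem_spanOf σ rfl⟩, by simpa⟩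
  refine choices_ne_nil hτ hσ hx rfl (.inr ⟨{y}, hyC, {y}, hyC, fun S hS => .inl ?_⟩) h
  rw [spanOf_le_iff]
  rintro _ rfl
  exact hxy ▸ hS.1.2.2

/-- Realizable types which are not expanded are types of hyperfigurations. -/
theorem exists_hyperfiguration_matches {τ : ConfigType} (hτ : Wf τ) {σ : ℕ → ProjSpace3 K}
    (hσ : Realizes τ σ) (hne : τ.1 ≠ []) (h : choices τ = []) {n : ℕ} (hn : τ.1.length ≤ n) :
    ∃ k : Hyperfiguration n, Matches τ k.space := by
  let φ : Fin τ.1.length → ℕ := fun i => τ.1[i]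
  have hφ : Function.Injective φ := fun i j hij => Fin.ext (hτ.nodup_points.getElem_inj_iff.1 hij)
  have hrange : ∀ x, x ∈ τ.1 ↔ x ∈ Set.range φ := fun x => by
    rw [List.mem_iff_get]; rfl
  have hmem : ∀ i, φ i ∈ τ.1 := fun i => (hrange _).2 ⟨i, rfl⟩
  have hinj : Function.Injective (σ ∘ φ) := fun i j hij =>
    hφ (injOn_of_choices_eq_nil hτ hσ h (hmem i) (hmem j) hij)
  have hspan : ∀ S, spanOf σ (φ '' S) = spanOf (σ ∘ φ) S := fun S => by
    rw [spanOf, Set.image_image]; rfl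
  have hspanning : ∀ i S, φ '' S ∈ spanning σ (φ i) ∩ {S | ∀ x ∈ S, x ∈ τ.1} ↔
      S ∈ spanning (σ ∘ φ) i := by
    intro i S
    have : ∀ x ∈ φ '' S, x ∈ τ.1 := by
      rintro _ ⟨i, -, rfl⟩
      exact hmem i
    simp only [spanning, Set.mem_inter_iff, Set.mem_ofPred_eq, hspan, ind_image hφ,
      hφ.mem_set_image, Function.comp_apply]
    exact and_iff_left this
  have hex : ∀ i, ∀ T ∈ spanning σ (φ i) ∩ {S | ∀ x ∈ S, x ∈ τ.1},
      ∃ S ∈ spanning (σ ∘ φ) i, φ '' S = T := by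
    intro i T hT
    obtain ⟨S, rfl⟩ := Set.subset_range_iff_exists_image_eq.1
      (show T ⊆ Set.range φ from fun x hx => (hrange x).1 (hT.2 x hx))
    exact ⟨S, (hspanning i S).1 hT, rfl⟩
  refine ⟨⟨⟨τ.1.length, Nat.lt_succ_of_le hn⟩, traceSpace (σ ∘ φ) hinj,
    ⟨⟨0, List.length_pos_iff.2 hne⟩⟩, fun i => ?_⟩, φ, hφ, hrange, fun A hA => ?_⟩
  · by_contra hi
    refine choices_ne_nil hτ hσ (hmem i) rfl ?_ h
    rcases exists_minimal_constraints hinj hi with h0 | ⟨F, hF, G, hG, hmin⟩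
    · refine .inl (Set.eq_empty_of_forall_notMem fun T hT => ?_)
      obtain ⟨S, hS, -⟩ := hex i T hT
      exact Set.notMem_empty S (h0 ▸ hS)
    · refine .inr ⟨φ '' F, (hspanning i F).2 hF, φ '' G, (hspanning i G).2 hG, fun T hT => ?_⟩
      obtain ⟨S, hS, rfl⟩ := hex i T hT
      rw [hspan, hspan, hspan]
      exact hmin S hS
  · rw [hσ A hA, traceSpace_indep_iff hinj, ← ind_image hφ, Set.image_preimage_eq_of_subset]
    exact fun x hx => (hrange x).1 (hA hx)

/-- Only the constant map at the base point is supported on no labels, and only the empty set has to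
be tested. -/
theorem count_of_points_eq_nil (K : Type v) [Field K] {τ : ConfigType} (h : τ.1 = []) :
    count K τ = if [] ∈ τ.2 then 1 else 0 := by
  have hreal : ∀ σ : ℕ → ProjSpace3 K, Realizes τ σ ↔ [] ∈ τ.2 := by
    intro σ
    have : Has τ.2 [] ↔ [] ∈ τ.2 := by
      constructor
      · rintro ⟨T, hT, h1, -⟩
        rwa [← List.subset_nil.1 h1]
      · exact has_of_mem
    simp [Realizes, h, this, ind_empty]
  split_ifs with h0
  · have : realizations K τ = {fun _ => base K} := by
      ext σ
      simp [realizations, hreal, h0, h, funext_iff]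
    rw [count, this, Set.ncard_singleton]
  · have : realizations K τ = ∅ := by
      ext σ
      simp [realizations, hreal, h0]
    rw [count, this, Set.ncard_empty]

end ConfigType

/-! ### Assembly of the polynomials. -/

open Classical in
/-- The sum over the isomorphism classes of hyperfigurations has at most one term for each type. -/
theorem sum_ite_matches (K : Type v) [Field K] {τ : ConfigType} (hτ : τ.Wf) (hne : τ.1 ≠ [])
    (h : τ.choices = []) {n : ℕ} (hn : τ.1.length ≤ n) :
    (∑ k : HyperfigurationClass n, if τ.Matches k.out.space then (k.numRealizations K : ℤ) else 0) =
      τ.count K := by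
  have hnum : ∀ k : HyperfigurationClass n, k.numRealizations K = k.out.space.numRealizations K :=
    fun k => by
      conv_lhs => rw [← Quotient.out_eq k]
      rfl
  by_cases hex : ∃ k : Hyperfiguration n, τ.Matches k.space
  · obtain ⟨k, hk⟩ := hex
    have hout : τ.Matches (Quotient.mk _ k : HyperfigurationClass n).out.space :=
      hk.of_iso (Quotient.mk_out (s := Hyperfiguration.isoSetoid n) k).symm
    rw [Finset.sum_eq_single (Quotient.mk _ k)]
    · rw [if_pos hout, hnum, hout.count_eq K]
    · intro b _ hb
      refine if_neg fun hb' => hb ?_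
      rw [← Quotient.out_eq b]
      exact Quotient.sound (hb'.iso hk)
    · exact fun h => absurd (Finset.mem_univ _) h
  · rw [Finset.sum_eq_zero fun k _ => if_neg fun h => hex ⟨_, h⟩]
    -- A terminal type that matches no hyperfiguration is not realizable, so both sides vanish.
    have : ConfigType.realizations K τ = ∅ := by
      by_contra hne'
      obtain ⟨σ, hσ⟩ := Set.nonempty_iff_ne_empty.2 hne'
      exact hex (ConfigType.exists_hyperfiguration_matches hτ hσ.2 hne h hn)
    rw [ConfigType.count, this, Set.ncard_empty]
    rfl

open Classical in
theorem polyOfCoeffs_hyperPart {c : PlanarCode} (hwf : ∀ t ∈ c.type.run, t.2.2.Wf) {n : ℕ}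
    (k : Hyperfiguration n) {d : PlanarCode} (hd : d.Describes k.space) :
    polyOfCoeffs (hyperPart c d) = ((c.type.run.filter fun t =>
      ¬ t.2.2.1 = [] ∧ t.2.2.Matches k.space).map ConfigTerm.monomial).sum := by
  rw [hyperPart, ConfigTerm.polyOfCoeffs_coeffs]
  congr 2
  refine List.filter_congr fun t ht => ?_
  simp only [ConfigType.matchesCode_iff (hwf t ht).nodup_points hd]

theorem List.sum_map_filter_eq_sum_ite {T M : Type*} [AddMonoid M] (l : List T) (P : T → Prop)
    [DecidablePred P] (f : T → M) :
    ((l.filter fun t => P t).map f).sum = (l.map fun t => if P t then f t else 0).sum := by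
  induction l with
  | nil => rfl
  | cons a l ih => by_cases h : P a <;> simp [h, ih]

theorem mainTheorem6 :
    ∃ (r : PlanarCode → List ℤ) (rh : PlanarCode → PlanarCode → List ℤ),
      Computable r ∧ Computable₂ rh ∧
      ∀ (P : Type u) [Finite P] (f : PlanarSpace P) (c : PlanarCode), c.Describes f →
        ∃ (R : ℤ[X]) (Rh : HyperfigurationClass (Nat.card P) → ℤ[X]),
          (∀ (K : Type v) [Field K] [Finite K],
            (f.numRealizations K : ℤ) = R.eval (Nat.card K : ℤ) +
              ∑ h : HyperfigurationClass (Nat.card P),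
                (Rh h).eval (Nat.card K : ℤ) * (h.numRealizations K : ℤ)) ∧
          polyOfCoeffs (r c) = R ∧
          ∀ (h : Hyperfiguration (Nat.card P)) (d : PlanarCode), d.Describes h.space →
            polyOfCoeffs (rh c d) = Rh (Quotient.mk _ h) := by
  classical
  refine ⟨polyPart, hyperPart, primrec_polyPart.to_comp, primrec_hyperPart.to_comp,
    fun P _ f c hc => ?_⟩
  -- This part of `run_spec` does not involve the field, so any finite field serves.
  have hwf : ∀ t ∈ c.type.run, t.2.2.Wf ∧ t.2.2.1.length ≤ c.type.1.length ∧
      t.2.2.choices = [] := (ConfigType.run_spec (ZMod 2) c.wf_type).2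
  -- The polynomial of a class is defined through a chosen representative; isomorphism invariance of
  -- `Matches` later identifies it with the output for any description.
  refine ⟨polyOfCoeffs (polyPart c), fun h => ((c.type.run.filter fun t =>
    ¬ t.2.2.1 = [] ∧ t.2.2.Matches h.out.space).map ConfigTerm.monomial).sum,
    fun K _ _ => ?_, rfl, fun h d hd => ?_⟩
  · have hcard : c.type.1.length = Nat.card P := by
      obtain ⟨e, -⟩ := hc
      rw [Nat.card_congr e, PlanarCode.type, List.length_range, Nat.card_fin]
    have hev (l : List ℤ[X]) : l.sum.eval (Nat.card K : ℤ) = (l.map (eval (Nat.card K : ℤ))).sum := by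
      rw [← coe_evalRingHom, map_list_sum]
    rw [← hc.matches_type.count_eq K, ← (ConfigType.run_spec K c.wf_type).1, polyPart,
      ConfigTerm.polyOfCoeffs_coeffs, List.sum_map_filter_eq_sum_ite, hev, List.map_map]
    have hR : ∀ h : HyperfigurationClass (Nat.card P),
        ((c.type.run.filter fun t => ¬ t.2.2.1 = [] ∧ t.2.2.Matches h.out.space).map
          ConfigTerm.monomial).sum.eval (Nat.card K : ℤ) * (h.numRealizations K : ℤ) =
        (c.type.run.map fun t => if ¬ t.2.2.1 = [] ∧ t.2.2.Matches h.out.space then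
          (ConfigTerm.monomial t).eval (Nat.card K : ℤ) * (h.numRealizations K : ℤ) else 0).sum := by
      intro h
      rw [List.sum_map_filter_eq_sum_ite, hev, List.map_map, ← List.sum_map_mul_right]
      congr 2
      funext t
      simp only [Function.comp_apply]
      split_ifs <;> simp
    simp only [hR]
    have hswap : ∀ (l : List ConfigTerm)
        (F : HyperfigurationClass (Nat.card P) → ConfigTerm → ℤ),
        ∑ h, (l.map (F h)).sum = (l.map fun t => ∑ h, F h t).sum := by
      intro l F
      induction l with
      | nil => simp
      | cons a l ih => simp [Finset.sum_add_distrib, ih]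
    rw [hswap, ← List.sum_map_add]
    congr 1
    -- The identity holds term by term: a term without labels enters only `R`, and a term with
    -- labels only the sum over classes.
    refine List.map_congr_left fun t ht => ?_
    obtain ⟨h1, h2, h3⟩ := hwf t ht
    rw [← ConfigTerm.eval_monomial]
    by_cases hnil : t.2.2.1 = []
    · rw [ConfigType.count_of_points_eq_nil K hnil]
      by_cases h0 : [] ∈ t.2.2.2 <;> simp [hnil, h0]
    · rw [← sum_ite_matches K h1 hnil h3 (hcard ▸ h2), Finset.mul_sum]
      simp [hnil]
  · rw [polyOfCoeffs_hyperPart (fun t ht => (hwf t ht).1) h hd]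
    congr 2
    refine List.filter_congr fun t ht => ?_
    have hiso : h.space.Iso (Quotient.mk _ h : HyperfigurationClass (Nat.card P)).out.space :=
      (Quotient.mk_out (s := Hyperfiguration.isoSetoid _) h).symm
    have : t.2.2.Matches h.space ↔
        t.2.2.Matches (Quotient.mk _ h : HyperfigurationClass (Nat.card P)).out.space :=
      ⟨fun h' => h'.of_iso hiso, fun h' => h'.of_iso hiso.symm⟩
    simp only [this]
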